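/- Let $c\ge 1$. There is an integer $k\ge 2$, depending only on $c$, such that the following holds. Let $M$ be a $C^\infty$ manifold of dimension $c$ with a (continuous) Riemannian metric and its Riemannian distance; let $0\le r\le\infty$, $0<\nu<1$ and $\alpha>0$. For every $x\in M$ and all integers $s,u\ge 0$ with $s+u=c$ there are arcs of $C^r$-diffeomorphisms $\phi_1(\varepsilon),\dots,\phi_k(\varepsilon)$ of $M$, $\varepsilon\ge 0$ (continuous in $\varepsilon$ both in the compact-open $C^r$ topology and in the uniform distance), with $\phi_i(0)=\mathrm{id}$ for $i=1,\dots,k$, and, for every $\varepsilon>0$, a bounded open set $D=D(\varepsilon)\subset B_{2\varepsilon}(x)$ and a number $\delta=\delta(\varepsilon)>0$ such that $B=B_\delta(x)\subset D$ is a blending region of $cs$-index $s$ with respect to $\{\phi_1(\varepsilon),\dots,\phi_k(\varepsilon)\}$ on $D$. More precisely, $B$ is a $cs$-blending region if $s>0$ and a $cu$-blending region if $s<c$; so it is a double-blending region if $0<s<c$. Here $B$ is a $cs$-blending region (respectively $cu$-blending region) of $cs$-index $s$ and $cu$-index $u$ with respect to $\{\phi_1,\dots,\phi_k\}$ on $D$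 if: (1) there are constants $\gamma>\nu^{\alpha}$ and $\gamma'<\nu^{-\alpha}$ with $\gamma\, d(y,z)\le d(\phi_i(y),\phi_i(z))\le\gamma'\, d(y,z)$ for all $i,y,z$, that is, the one-step skew-product $\Phi(\xi,y)=(\tau\xi,\phi_{\xi_0}(y))$ on $\{1,\dots,k\}^{\mathbb Z}\times M$, with $\tau$ the shift, is partially hyperbolic; (2) $B$ and $D$ are bounded open sets with $\overline B\subset D$; (3) the maximal invariant set $\Gamma=\bigcap_{n\in\mathbb Z}\Phi^n(\{1,\dots,k\}^{\mathbb Z}\times\overline D)$ is a non-empty transitive hyperbolic set of indices $(s,u)$; (4) $s>0$ and $\overline B\subset\bigcup_i\phi_i(B)$ (respectively $u>0$ and $\overline B\subset\bigcup_i\phi_i^{-1}(B)$). Transitive means that $\Gamma$ contains a forward orbit of $\Phi$ that is dense in $\Gamma$. Write $\phi^n_\xi$ for the fibre component of $\Phi^n$ over $\xi$, $n\in\mathbb Z$. Hyperbolic of indices $(s,u)$ means that $\Gamma$ is compact and $\Phi$-invariant and that there are $\eta,C,\rho>0$ and $0<\kappa<1$ such that, for every $(\xi,y)\in\Gamma$,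 the local stable set $W^s=\{z: d(\phi_\xi^n(y),\phi_\xi^n(z))\le\eta\ \ \forall n\ge0\}$ satisfies $d(\phi_\xi^n(y),\phi_\xi^n(z))\le C\kappa^n d(y,z)$ for $z\in W^s$, $n\ge 0$; the local unstable set $W^u$ satisfies the same with $\phi_\xi^{-n}$ in place of $\phi_\xi^n$; and there is a homeomorphism $h$ from an open set containing $B_\rho(y)$ onto an open subset of $\mathbb R^s\times\mathbb R^u$ for which $W^s$ and $W^u$ are, in the domain of $h$, the slices $\mathbb R^s\times\{h(y)_2\}$ and $\{h(y)_1\}\times\mathbb R^u$ through $y$. If $r\ge1$ it is required moreover that there are subspaces with $T_yM=E^s(\xi,y)\oplus E^u(\xi,y)$ for $(\xi,y)\in\Gamma$, of dimensions $s$ and $u$, invariant under $D\phi_{\xi_0}$, and constants $C>0$, $0<\kappa<1$ with $\|D\phi_\xi^n(y)v\|\le C\kappa^n\|v\|$ for $v\in E^s(\xi,y)$ and $\|D\phi_\xi^{-n}(y)v\|\le C\kappa^n\|v\|$ for $v\in E^u(\xi,y)$, $n\ge0$. -/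

import Mathlib

open Set Filter Topology Manifold ContDiff Bundle
open scoped ENNReal NNReal

/-- The one-step symbolic skew-product `τ ⋉ (φ_i)` over the two-sided full shift on the alphabet
`ι`, acting on `ι^ℤ × M` by `(ξ, x) ↦ (τ ξ, φ_{ξ 0} x)`, where `(τ ξ) j = ξ (j + 1)`. -/
def oneStepSkewProduct {ι M : Type*} (φ : ι → M ≃ M) : Equiv.Perm ((ℤ → ι) × M) where
  toFun p := (fun j => p.1 (j + 1), φ (p.1 0) p.2)
  invFun p := (fun j => p.1 (j - 1), (φ (p.1 (-1))).symm p.2)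
  left_inv p := by simp
  right_inv p := by simp

/-- The fibre component of the `n`-th iterate (`n ∈ ℤ`) of the skew-product over `ξ`:
`φ_{ξ (n-1)} ∘ ⋯ ∘ φ_{ξ 0}` for `n ≥ 0` and `φ_{ξ n}⁻¹ ∘ ⋯ ∘ φ_{ξ (-1)}⁻¹` for `n < 0`. -/
def fiberIterate {ι M : Type*} (φ : ι → M ≃ M) (n : ℤ) (ξ : ℤ → ι) (x : M) : M :=
  ((oneStepSkewProduct φ ^ n) (ξ, x)).2

/-- The maximal invariant set `⋂_{n ∈ ℤ} Φⁿ(ι^ℤ × closure D)` of the skew-product. -/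
def maximalInvariantSet {ι M : Type*} [TopologicalSpace M] (φ : ι → M ≃ M) (D : Set M) :
    Set ((ℤ → ι) × M) :=
  ⋂ n : ℤ, (oneStepSkewProduct φ ^ n) '' (univ ×ˢ closure D)

/-- Partial hyperbolicity of the one-step skew-product, where the shift space carries the metric
`ν ^ min {|j| : ξ j ≠ ζ j}` and `α` is the Hölder exponent: the fibre maps are bi-Lipschitz with
constants strictly between `ν ^ α` and `ν ^ (-α)`. Hölder dependence on `ξ` is automatic
for one-step maps. -/
def IsPartiallyHyperbolic {ι M : Type*} [EMetricSpace M] (ν α : ℝ) (φ : ι → M ≃ M) : Prop :=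
  ∃ γ γ' : ℝ, ν ^ α < γ ∧ γ' < ν ^ (-α) ∧ ∀ i x y,
    ENNReal.ofReal γ * edist x y ≤ edist (φ i x) (φ i y) ∧
    edist (φ i x) (φ i y) ≤ ENNReal.ofReal γ' * edist x y

/-- The fibre local stable set of size `η` of the point `(ξ, x)`. -/
def fiberStableSet {ι M : Type*} [EMetricSpace M] (φ : ι → M ≃ M) (η : ℝ)
    (ξ : ℤ → ι) (x : M) : Set M :=
  {y | ∀ n : ℕ, edist (fiberIterate φ n ξ x) (fiberIterate φ n ξ y) ≤ ENNReal.ofReal η}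

/-- The fibre local unstable set of size `η` of the point `(ξ, x)`. -/
def fiberUnstableSet {ι M : Type*} [EMetricSpace M] (φ : ι → M ≃ M) (η : ℝ)
    (ξ : ℤ → ι) (x : M) : Set M :=
  {y | ∀ n : ℕ, edist (fiberIterate φ (-n) ξ x) (fiberIterate φ (-n) ξ y) ≤ ENNReal.ofReal η}

/-- Uniform hyperbolicity along the fibres, for skew-products of homeomorphisms: on `Γ` the local
stable (unstable) sets are contracted exponentially by the forward (backward) iterates, and there
are local coordinates around `x`, of uniform size, in which the local stable and unstable
sets of `(ξ, x)` are the slices through `x` of a product of an `s`-dimensional and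
a `u`-dimensional space. -/
def IsTopologicallyHyperbolic {ι M : Type*} [EMetricSpace M] (φ : ι → M ≃ M)
    (Γ : Set ((ℤ → ι) × M)) (s u : ℕ) : Prop :=
  ∃ η C κ ρ : ℝ, 0 < η ∧ 0 < C ∧ 0 < κ ∧ κ < 1 ∧ 0 < ρ ∧ ∀ ξ x, (ξ, x) ∈ Γ →
    (∀ y ∈ fiberStableSet φ η ξ x, ∀ n : ℕ,
      edist (fiberIterate φ n ξ x) (fiberIterate φ n ξ y)
        ≤ ENNReal.ofReal (C * κ ^ n) * edist x y) ∧
    (∀ y ∈ fiberUnstableSet φ η ξ x, ∀ n : ℕ,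
      edist (fiberIterate φ (-n) ξ x) (fiberIterate φ (-n) ξ y)
        ≤ ENNReal.ofReal (C * κ ^ n) * edist x y) ∧
    ∃ h : OpenPartialHomeomorph M (EuclideanSpace ℝ (Fin s) × EuclideanSpace ℝ (Fin u)),
      Metric.eball x (ENNReal.ofReal ρ) ⊆ h.source ∧
      ∀ y ∈ h.source,
        (y ∈ fiberStableSet φ η ξ x ↔ (h y).2 = (h x).2) ∧
        (y ∈ fiberUnstableSet φ η ξ x ↔ (h y).1 = (h x).1)

/-- Uniform hyperbolicity along the fibres, for skew-products of `C¹` diffeomorphisms: over `Γ`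
there is an invariant splitting of the tangent spaces of the fibre into an `s`-dimensional
uniformly contracted and a `u`-dimensional uniformly expanded subspace. -/
def IsDifferentiablyHyperbolic {c : ℕ} {ι M : Type*} [EMetricSpace M]
    [ChartedSpace (EuclideanSpace ℝ (Fin c)) M]
    [RiemannianBundle (fun x : M => TangentSpace (𝓡 c) x)]
    (φ : ι → M ≃ M) (Γ : Set ((ℤ → ι) × M)) (s u : ℕ) : Prop :=
  ∃ (Es Eu : ∀ (_ : ℤ → ι) (x : M), Submodule ℝ (TangentSpace (𝓡 c) x)) (C κ : ℝ),
    0 < C ∧ 0 < κ ∧ κ < 1 ∧ ∀ ξ x, (ξ, x) ∈ Γ →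
      IsCompl (Es ξ x) (Eu ξ x) ∧
      Module.finrank ℝ (Es ξ x) = s ∧ Module.finrank ℝ (Eu ξ x) = u ∧
      (Es ξ x).map (mfderiv (𝓡 c) (𝓡 c) (φ (ξ 0)) x).toLinearMap
        = Es (fun j => ξ (j + 1)) (φ (ξ 0) x) ∧
      (Eu ξ x).map (mfderiv (𝓡 c) (𝓡 c) (φ (ξ 0)) x).toLinearMap
        = Eu (fun j => ξ (j + 1)) (φ (ξ 0) x) ∧
      (∀ v ∈ Es ξ x, ∀ n : ℕ,
        ‖mfderiv (𝓡 c) (𝓡 c) (fiberIterate φ n ξ) x v‖ ≤ C * κ ^ n * ‖v‖) ∧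
      (∀ v ∈ Eu ξ x, ∀ n : ℕ,
        ‖mfderiv (𝓡 c) (𝓡 c) (fiberIterate φ (-n) ξ) x v‖ ≤ C * κ ^ n * ‖v‖)

/-- `Γ` is a hyperbolic set, with `cs`-index `s` and `cu`-index `u`, of the one-step skew-product of
the `C^r` diffeomorphisms `φ i`. For `r = 0` this is the metric notion; for `r ≥ 1` the
tangent spaces split in addition. -/
structure IsHyperbolicSet {c : ℕ} {ι M : Type*} [TopologicalSpace ι] [EMetricSpace M]
    [ChartedSpace (EuclideanSpace ℝ (Fin c)) M]
    [RiemannianBundle (fun x : M => TangentSpace (𝓡 c) x)] (r : ℕ∞)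
    (φ : ι → M ≃ₘ^r⟮𝓡 c, 𝓡 c⟯ M) (Γ : Set ((ℤ → ι) × M)) (s u : ℕ) : Prop where
  isCompact : IsCompact Γ
  image_eq : oneStepSkewProduct (fun i => (φ i).toEquiv) '' Γ = Γ
  topological : IsTopologicallyHyperbolic (fun i => (φ i).toEquiv) Γ s u
  differentiable : 1 ≤ r →
    IsDifferentiablyHyperbolic (c := c) (fun i => (φ i).toEquiv) Γ s u

/-- `Γ` is a transitive set of `Φ`: it contains a forward orbit that is dense in it. -/
def IsTransitiveSet {X : Type*} [TopologicalSpace X] (Φ : Equiv.Perm X) (Γ : Set X) : Prop :=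
  ∃ p ∈ Γ, (∀ n : ℕ, (Φ ^ n) p ∈ Γ) ∧ Γ ⊆ closure (range fun n : ℕ => (Φ ^ n) p)

/-- The requirements common to all blending regions `B` on `D` with respect to `{φ i}`, with
`cs`-index `s` and `cu`-index `u` (the indices of the maximal invariant set in `D`). -/
structure IsBlendingData {c : ℕ} {ι M : Type*} [TopologicalSpace ι] [EMetricSpace M]
    [ChartedSpace (EuclideanSpace ℝ (Fin c)) M]
    [RiemannianBundle (fun x : M => TangentSpace (𝓡 c) x)] (ν α : ℝ) (r : ℕ∞)
    (φ : ι → M ≃ₘ^r⟮𝓡 c, 𝓡 c⟯ M) (B D : Set M) (s u : ℕ) : Prop where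
  partiallyHyperbolic : IsPartiallyHyperbolic ν α (fun i => (φ i).toEquiv)
  isOpen_B : IsOpen B
  isOpen_D : IsOpen D
  bounded_B : Metric.ediam B ≠ ⊤
  bounded_D : Metric.ediam D ≠ ⊤
  closure_subset : closure B ⊆ D
  hyperbolic :
    IsHyperbolicSet r φ (maximalInvariantSet (fun i => (φ i).toEquiv) D) s u
  transitive : IsTransitiveSet (oneStepSkewProduct fun i => (φ i).toEquiv)
    (maximalInvariantSet (fun i => (φ i).toEquiv) D)

/-- `B` is a `cs`-blending region with respect to `{φ i}` on `D`. -/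
structure IsCsBlendingRegion {c : ℕ} {ι M : Type*} [TopologicalSpace ι] [EMetricSpace M]
    [ChartedSpace (EuclideanSpace ℝ (Fin c)) M]
    [RiemannianBundle (fun x : M => TangentSpace (𝓡 c) x)] (ν α : ℝ) (r : ℕ∞)
    (φ : ι → M ≃ₘ^r⟮𝓡 c, 𝓡 c⟯ M) (B D : Set M) (s u : ℕ) : Prop
    extends IsBlendingData ν α r φ B D s u where
  cs_cover : closure B ⊆ ⋃ i, φ i '' B
  cs_index_pos : 0 < s

/-- `B` is a `cu`-blending region with respect to `{φ i}` on `D`. -/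
structure IsCuBlendingRegion {c : ℕ} {ι M : Type*} [TopologicalSpace ι] [EMetricSpace M]
    [ChartedSpace (EuclideanSpace ℝ (Fin c)) M]
    [RiemannianBundle (fun x : M => TangentSpace (𝓡 c) x)] (ν α : ℝ) (r : ℕ∞)
    (φ : ι → M ≃ₘ^r⟮𝓡 c, 𝓡 c⟯ M) (B D : Set M) (s u : ℕ) : Prop
    extends IsBlendingData ν α r φ B D s u where
  cu_cover : closure B ⊆ ⋃ i, (φ i).symm '' B
  cu_index_pos : 0 < u

/-- An arc `ε ↦ φ ε`, `ε ≥ 0`, of `C^r` diffeomorphisms: it is continuous for the uniform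
distance, and the derivatives of order `m ≤ r` in local charts depend continuously on
`(ε, y)` (that is, it is also continuous for the compact-open `C^r` topology). -/
structure IsArc {c : ℕ} {M : Type*} [EMetricSpace M]
    [ChartedSpace (EuclideanSpace ℝ (Fin c)) M] (r : ℕ∞)
    (φ : ℝ≥0 → M ≃ₘ^r⟮𝓡 c, 𝓡 c⟯ M) : Prop where
  uniform : ∀ ε₀, TendstoUniformly (fun ε y => φ ε y) (φ ε₀) (𝓝 ε₀)
  derivatives : ∀ (ε₀ : ℝ≥0) (y₀ : M) (m : ℕ), (m : ℕ∞) ≤ r →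
    ContinuousAt
      (fun p : ℝ≥0 × EuclideanSpace ℝ (Fin c) =>
        iteratedFDeriv ℝ m
          (fun v => extChartAt (𝓡 c) (φ ε₀ y₀) (φ p.1 ((extChartAt (𝓡 c) y₀).symm v))) p.2)
      (ε₀, extChartAt (𝓡 c) y₀ y₀)

/-!
The blending regions are built from affine maps in one chart. Around `x` there is a smooth chart `e`
with values in `ℝ^s × ℝ^u` that is an isometry at `x`; since the metric is continuous, `e` is almost
isometric on a small ball (`exists_isNormalizedChart`, `IsNormalizedChart.exists_isControlled`). For
vectors `v i` of norm at most `2` and a small `θ ≥ 0` consider the maps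

  `w ↦ w + θ χ(w) (saddle w + (θ / 4) v i)`, where `saddle (p, q) = (-p, q)`,

with a bump function `χ` that is fixed once and for all. These maps are `C^1`-close to the identity
for small `θ`, so they are diffeomorphisms, and they extend by the identity to diffeomorphisms of `M`
that depend smoothly on `θ` (`chartDiffeomorph`, `contMDiffAt_extendByChart`). The arcs are obtained
by inserting `θ = min (ε / 4) θ₀` (`isArc_of_cutoffSaddle`). Only `θ` depends on `ε`; the support does
not shrink, so that the `C^r`-norms of the perturbations tend to zero with `θ`.

* *Partial hyperbolicity.* A map whose derivative, and that of its inverse, has norm at most `q ^ 3`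
  is bi-Lipschitz with this constant, as one sees by measuring lengths of paths. Here `q > 1` can be
  taken so close to `1` that `q ^ 3 < ν ^ (-α)` (`IsControlled.norm_mfderiv_extendByChart`,
  `edist_bounds_of_norm_mfderiv`).
* *The maximal invariant set.* Where `χ = 1` the maps are the affine saddles
  `(p, q) ↦ ((1 - θ) p, (1 + θ) q) + (θ ^ 2 / 4) v i`. Over every `ξ` there is exactly one orbit that
  stays in the chart ball `D` of radius `θ`, given by geometric series, and it depends continuously on
  `ξ`. Hence the maximal invariant set is the graph of a continuous map on the full shift, and it is
  compact and transitive (`IsLocalSaddle.exists_eq_range`, `exists_dense_forward_shift_orbit`).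
* *Hyperbolicity.* The difference of two orbits over the same `ξ` is an orbit of the linear saddle as
  long as both stay in the region where `χ = 1`. Bounded forward orbits of the linear saddle lie in
  `ℝ^s`, bounded backward orbits lie in `ℝ^u`. The local stable and unstable sets are therefore the
  slices of the chart, and the invariant splitting is the one given by the chart
  (`IsLocalSaddle.isTopologicallyHyperbolic`, `IsLocalSaddle.isDifferentiablyHyperbolic`).
* *Covering.* Both `B` and the images of its points under the linear saddle have size of order
  `θ ^ 2`, like the translation parts. So if the `v i` form a sufficiently fine net of the ball of
  radius `2`, every point of the closure of `B` is moved into `B` by one of the maps, and by one of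
  the inverse maps (`IsLocalSaddle.cu_cover`, `IsLocalSaddle.cs_cover`). The fineness of the net does
  not depend on `M`, `ν`, `α` or `ε`, so neither does the number `k` of maps.
-/

/-! ### Lengths of paths and Lipschitz bounds -/

section Lengths

open MeasureTheory

variable {c : ℕ} {M : Type*} [EMetricSpace M] [ChartedSpace (EuclideanSpace ℝ (Fin c)) M]
  [RiemannianBundle (fun x : M => TangentSpace (𝓡 c) x)]

/-- The derivative of a vector valued map on `M`, as a linear map into the vector space itself
rather than into its tangent space at the image point. -/
noncomputable def vectorDeriv {F : Type*} [NormedAddCommGroup F] [NormedSpace ℝ F] (f : M → F)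
    (y : M) : TangentSpace (𝓡 c) y →L[ℝ] F :=
  mfderiv (𝓡 c) 𝓘(ℝ, F) f y

/-- The increment of a vector valued map along a path is bounded by the length of the path. -/
theorem enorm_sub_le_mul_pathELength {F : Type*} [NormedAddCommGroup F] [NormedSpace ℝ F]
    [CompleteSpace F]
    {f : M → F} {U : Set M} (hU : IsOpen U) (hf : ContMDiffOn (𝓡 c) 𝓘(ℝ, F) 1 f U) {C : ℝ}
    (hC : 0 ≤ C)
    (h : ∀ y ∈ U, ∀ v : TangentSpace (𝓡 c) y,
      ‖vectorDeriv f y v‖ ≤ C * ‖v‖)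
    {p : ℝ → M} (hp : ContMDiff 𝓘(ℝ, ℝ) (𝓡 c) 1 p) (hpU : ∀ t ∈ Icc (0 : ℝ) 1, p t ∈ U) :
    ‖f (p 1) - f (p 0)‖ₑ ≤ ENNReal.ofReal C * Manifold.pathELength (𝓡 c) p 0 1 := by
  have hfp : ContMDiffOn 𝓘(ℝ, ℝ) 𝓘(ℝ, F) 1 (f ∘ p) (Icc 0 1) :=
    hf.comp hp.contMDiffOn hpU
  calc ‖f (p 1) - f (p 0)‖ₑ
      ≤ ∫⁻ t in Icc (0 : ℝ) 1, ‖derivWithin (f ∘ p) (Icc 0 1) t‖ₑ :=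
        enorm_sub_le_lintegral_derivWithin_Icc_of_contDiffOn_Icc
          (contMDiffOn_iff_contDiffOn.1 hfp) zero_le_one
    _ ≤ ∫⁻ t in Icc (0 : ℝ) 1, ENNReal.ofReal C *
          ‖mfderivWithin 𝓘(ℝ, ℝ) (𝓡 c) p (Icc 0 1) t 1‖ₑ := by
        refine setLIntegral_mono' measurableSet_Icc fun t ht => ?_
        have hd : mfderivWithin 𝓘(ℝ, ℝ) 𝓘(ℝ, F) (f ∘ p) (Icc 0 1) t
            = (mfderiv (𝓡 c) 𝓘(ℝ, F) f (p t)).comp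
              (mfderivWithin 𝓘(ℝ, ℝ) (𝓡 c) p (Icc 0 1) t) := by
          apply mfderiv_comp_mfderivWithin
          · exact (hf.contMDiffAt (hU.mem_nhds (hpU t ht))).mdifferentiableAt one_ne_zero
          · exact (hp.mdifferentiable one_ne_zero _).mdifferentiableWithinAt
          · rw [uniqueMDiffWithinAt_iff_uniqueDiffWithinAt]
            exact uniqueDiffOn_Icc zero_lt_one _ ht
        have h1 : derivWithin (f ∘ p) (Icc 0 1) t
            = vectorDeriv f (p t)
              (mfderivWithin 𝓘(ℝ, ℝ) (𝓡 c) p (Icc 0 1) t 1) := by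
          rw [← fderivWithin_derivWithin, ← mfderivWithin_eq_fderivWithin, hd]
          rfl
        rw [h1, ← ofReal_norm, ← ofReal_norm, ← ENNReal.ofReal_mul hC]
        exact ENNReal.ofReal_le_ofReal (h _ (hpU t ht) _)
    _ = ENNReal.ofReal C * Manifold.pathELength (𝓡 c) p 0 1 := by
        rw [Manifold.pathELength_eq_lintegral_mfderivWithin_Icc,
          ← lintegral_const_mul' _ _ ENNReal.ofReal_ne_top]

variable [IsRiemannianManifold (𝓡 c) M]

/-- Almost minimizing paths between two points. -/
theorem exists_path_of_edist_lt {y z : M} {b : ℝ≥0∞} (h : edist y z < b) :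
    ∃ p : ℝ → M, p 0 = y ∧ p 1 = z ∧ ContMDiff 𝓘(ℝ, ℝ) (𝓡 c) 1 p ∧
      Manifold.pathELength (𝓡 c) p 0 1 < b := by
  rw [IsRiemannianManifold.out (I := 𝓡 c) y z] at h
  obtain ⟨p, h0, h1, hp, hl, -⟩ :=
    Manifold.exists_lt_locally_constant_of_riemannianEDist_lt h zero_lt_one
  exact ⟨p, h0, h1, hp, hl⟩

theorem edist_le_pathELength {p : ℝ → M} (hp : ContMDiff 𝓘(ℝ, ℝ) (𝓡 c) 1 p) {t : ℝ}
    (ht : t ∈ Icc (0 : ℝ) 1) :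
    edist (p 0) (p t) ≤ Manifold.pathELength (𝓡 c) p 0 1 := by
  rw [IsRiemannianManifold.out (I := 𝓡 c)]
  exact (Manifold.riemannianEDist_le_pathELength hp.contMDiffOn rfl rfl ht.1).trans
    (Manifold.pathELength_mono le_rfl ht.2)

/-- A map whose derivative has norm at most `C` everywhere is `C`-Lipschitz for the Riemannian
distance. -/
theorem edist_map_le_of_norm_mfderiv_le {f : M → M} (hf : ContMDiff (𝓡 c) (𝓡 c) 1 f) {C : ℝ}
    (hC : 0 < C)
    (h : ∀ (y : M) (v : TangentSpace (𝓡 c) y), ‖mfderiv (𝓡 c) (𝓡 c) f y v‖ ≤ C * ‖v‖) (y z : M) :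
    edist (f y) (f z) ≤ ENNReal.ofReal C * edist y z := by
  have key : ∀ b, edist y z < b → edist (f y) (f z) ≤ ENNReal.ofReal C * b := by
    intro b hb
    obtain ⟨p, h0, h1, hp, hl⟩ := exists_path_of_edist_lt (c := c) hb
    rw [IsRiemannianManifold.out (I := 𝓡 c)]
    calc riemannianEDist (𝓡 c) (f y) (f z)
        ≤ Manifold.pathELength (𝓡 c) (f ∘ p) 0 1 :=
          Manifold.riemannianEDist_le_pathELength (hf.comp hp).contMDiffOn (by simp [h0])
            (by simp [h1]) zero_le_one
      _ ≤ ENNReal.ofReal C * Manifold.pathELength (𝓡 c) p 0 1 := by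
          rw [Manifold.pathELength_eq_lintegral_mfderiv_Icc,
            Manifold.pathELength_eq_lintegral_mfderiv_Icc,
            ← lintegral_const_mul' _ _ ENNReal.ofReal_ne_top]
          refine lintegral_mono fun t => ?_
          have : mfderiv 𝓘(ℝ, ℝ) (𝓡 c) (f ∘ p) t
              = (mfderiv (𝓡 c) (𝓡 c) f (p t)).comp (mfderiv 𝓘(ℝ, ℝ) (𝓡 c) p t) :=
            mfderiv_comp t (hf.mdifferentiable one_ne_zero _) (hp.mdifferentiable one_ne_zero _)
          simp only [this]
          have := h (p t) (mfderiv 𝓘(ℝ, ℝ) (𝓡 c) p t (1 : ℝ))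
          rw [← ofReal_norm, ← ofReal_norm, ← ENNReal.ofReal_mul hC.le]
          exact ENNReal.ofReal_le_ofReal this
      _ ≤ ENNReal.ofReal C * b := by gcongr
  have hC0 : ENNReal.ofReal C ≠ 0 := by simpa using hC
  rw [mul_comm, ← ENNReal.div_le_iff_le_mul (Or.inl hC0) (Or.inl ENNReal.ofReal_ne_top)]
  refine le_of_forall_gt_imp_ge_of_dense fun b hb => ?_
  rw [ENNReal.div_le_iff_le_mul (Or.inl hC0) (Or.inl ENNReal.ofReal_ne_top), mul_comm]
  exact key b hb

end Lengths

/-! ### Charts that are isometric at a point -/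

section Charts

/-- The product `ℝ^s × ℝ^u` (with the sup norm of the two Euclidean norms) in which all local
constructions take place. -/
abbrev SplitSpace (s u : ℕ) : Type := EuclideanSpace ℝ (Fin s) × EuclideanSpace ℝ (Fin u)

/-- The Euclidean norm on `ℝ^s × ℝ^u`. -/
noncomputable def l2norm {s u : ℕ} (w : SplitSpace s u) : ℝ := ‖WithLp.toLp 2 w‖

theorem l2norm_add_le {s u : ℕ} (w z : SplitSpace s u) : l2norm (w + z) ≤ l2norm w + l2norm z :=
  norm_add_le (WithLp.toLp 2 w) (WithLp.toLp 2 z)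

theorem norm_le_l2norm {s u : ℕ} (w : SplitSpace s u) : ‖w‖ ≤ l2norm w := by
  have h : l2norm w ^ 2 = ‖w.1‖ ^ 2 + ‖w.2‖ ^ 2 := WithLp.prod_norm_sq_eq_of_L2 (WithLp.toLp 2 w)
  have h0 : 0 ≤ l2norm w := norm_nonneg _
  rw [Prod.norm_def]
  exact max_le (by nlinarith [sq_nonneg ‖w.2‖]) (by nlinarith [sq_nonneg ‖w.1‖])

theorem l2norm_le_two_mul {s u : ℕ} (w : SplitSpace s u) : l2norm w ≤ 2 * ‖w‖ := by
  have h : l2norm w ^ 2 = ‖w.1‖ ^ 2 + ‖w.2‖ ^ 2 := WithLp.prod_norm_sq_eq_of_L2 (WithLp.toLp 2 w)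
  have h1 := norm_fst_le w
  have h2 := norm_snd_le w
  have := norm_nonneg w.1
  have := norm_nonneg w.2
  nlinarith [norm_nonneg w]

variable {c : ℕ} {M : Type*} [EMetricSpace M] [ChartedSpace (EuclideanSpace ℝ (Fin c)) M]
  [RiemannianBundle (fun x : M => TangentSpace (𝓡 c) x)]

/-- A smooth chart `e` centred at `x` with values in `ℝ^s × ℝ^u` that is an isometry at `x`. As the
metric is only continuous, this is recorded through the fact that near `x` the derivative of `e`
distorts norms by factors arbitrarily close to `1`. -/
structure IsNormalizedChart {s u : ℕ} (x : M) (e : OpenPartialHomeomorph M (SplitSpace s u)) :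
    Prop where
  mem_source : x ∈ e.source
  map_base : e x = 0
  contMDiffOn : ContMDiffOn (𝓡 c) 𝓘(ℝ, SplitSpace s u) ∞ e e.source
  contMDiffOn_symm : ContMDiffOn 𝓘(ℝ, SplitSpace s u) (𝓡 c) ∞ e.symm e.target
  eventually_distortion : ∀ q : ℝ, 1 < q → ∀ᶠ y in 𝓝 x, ∀ v : TangentSpace (𝓡 c) y,
    l2norm (vectorDeriv (c := c) e y v) ≤ q * ‖v‖ ∧ ‖v‖ ≤ q * l2norm (vectorDeriv (c := c) e y v)

variable [IsManifold (𝓡 c) ∞ M]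
  [IsContinuousRiemannianBundle (EuclideanSpace ℝ (Fin c))
    (fun x : M => TangentSpace (𝓡 c) x)]

/-- The preferred chart at `x`, followed by the affine map that makes it an isometry at `x`. The
distortion bound is the continuity of the metric in the trivialization of the tangent bundle at
`x`. -/
theorem exists_isNormalizedChart {s u : ℕ} (hsu : s + u = c) (x : M) :
    ∃ e : OpenPartialHomeomorph M (SplitSpace s u), IsNormalizedChart (c := c) x e := by
  let E := EuclideanSpace ℝ (Fin c)
  let T := trivializationAt E (fun x : M => TangentSpace (𝓡 c) x) x
  have hx : x ∈ T.baseSet := FiberBundle.mem_baseSet_trivializationAt' x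
  let A : TangentSpace (𝓡 c) x ≃L[ℝ] E := T.continuousLinearEquivAt ℝ x hx
  have : FiniteDimensional ℝ (TangentSpace (𝓡 c) x) :=
    inferInstanceAs (FiniteDimensional ℝ E)
  have hfin : Module.finrank ℝ (TangentSpace (𝓡 c) x)
      = Module.finrank ℝ (WithLp 2 (SplitSpace s u)) := by
    have h1 : Module.finrank ℝ (TangentSpace (𝓡 c) x) = c := by
      rw [A.toLinearEquiv.finrank_eq]; simp [E]
    have h2 : Module.finrank ℝ (WithLp 2 (SplitSpace s u)) = s + u := by
      rw [(WithLp.linearEquiv 2 ℝ (SplitSpace s u)).finrank_eq]; simp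
    rw [h1, h2, hsu]
  let j : TangentSpace (𝓡 c) x ≃ₗᵢ[ℝ] WithLp 2 (SplitSpace s u) :=
    (stdOrthonormalBasis ℝ _).equiv (stdOrthonormalBasis ℝ _) (finCongr hfin)
  let J : E ≃L[ℝ] SplitSpace s u := A.symm.trans (j.toContinuousLinearEquiv.trans
    (WithLp.prodContinuousLinearEquiv 2 ℝ _ _))
  have hJ : ∀ w : E, l2norm (J w) = ‖A.symm w‖ := fun w => j.norm_map (A.symm w)
  let h : E ≃ₜ SplitSpace s u :=
    (Homeomorph.subRight (chartAt E x x)).trans J.toHomeomorph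
  have hh : ∀ w, h w = J (w - chartAt E x x) := fun w => rfl
  have hhsymm : ∀ w, h.symm w = J.symm w + chartAt E x x := fun w => rfl
  let e : OpenPartialHomeomorph M (SplitSpace s u) := (chartAt E x).transHomeomorph h
  have he : ∀ y, e y = J (chartAt E x y - chartAt E x x) := fun y => rfl
  have hhs : ContDiff ℝ ∞ h := J.contDiff.comp (contDiff_id.sub contDiff_const)
  have hhs' : ContDiff ℝ ∞ h.symm := J.symm.contDiff.add contDiff_const
  refine ⟨e, mem_chart_source E x, by simp [he], ?_, ?_, ?_⟩
  · exact hhs.contMDiff.comp_contMDiffOn (contMDiffOn_chart (x := x))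
  · exact (contMDiffOn_chart_symm (I := 𝓡 c) (x := x)).comp hhs'.contMDiff.contMDiffOn
      (fun w hw => hw)
  · intro q hq
    have hsrc : (chartAt E x).source ∈ 𝓝 x := chart_source_mem_nhds E x
    filter_upwards [hsrc,
      eventually_norm_symmL_trivializationAt_self_comp_lt E
        (fun x : M => TangentSpace (𝓡 c) x) x hq,
      eventually_norm_symmL_trivializationAt_comp_self_lt E
        (fun x : M => TangentSpace (𝓡 c) x) x hq] with y hy h1 h2 v
    have hyT : y ∈ T.baseSet := hy
    have hde : vectorDeriv (c := c) e y v = J (T.continuousLinearMapAt ℝ y v) := by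
      have hd : MDifferentiableAt (𝓡 c) 𝓘(ℝ, E) (extChartAt (𝓡 c) x) y :=
        mdifferentiableAt_extChartAt hy
      have hcomp : mfderiv (𝓡 c) 𝓘(ℝ, SplitSpace s u) (h ∘ extChartAt (𝓡 c) x) y
          = (mfderiv 𝓘(ℝ, E) 𝓘(ℝ, SplitSpace s u) h (extChartAt (𝓡 c) x y)).comp
            (mfderiv (𝓡 c) 𝓘(ℝ, E) (extChartAt (𝓡 c) x) y) :=
        mfderiv_comp y (hhs.contMDiff.mdifferentiable (by simp) _) hd
      have hJd : fderiv ℝ h (extChartAt (𝓡 c) x y) = J := by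
        have : HasFDerivAt (fun w => J w - J (chartAt E x x)) (J : E →L[ℝ] SplitSpace s u)
            (extChartAt (𝓡 c) x y) := J.hasFDerivAt.sub_const _
        rw [show (h : E → SplitSpace s u) = fun w => J w - J (chartAt E x x) from
          funext fun w => by rw [hh, map_sub]]
        exact this.fderiv
      have hee : (h ∘ extChartAt (𝓡 c) x : M → SplitSpace s u) = e := by
        ext1 z; simp [h, e]
      rw [mfderiv_eq_fderiv, hJd, hee,
        ← TangentBundle.continuousLinearMapAt_trivializationAt hy] at hcomp
      unfold vectorDeriv
      rw [hcomp]
      rfl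
    rw [hde, hJ]
    have hAs : ∀ w, A.symm w = T.symmL ℝ x w :=
      congrFun (T.symm_continuousLinearEquivAt_eq hx)
    have hA : ∀ w, T.continuousLinearMapAt ℝ x (T.symmL ℝ x w) = w := fun w =>
      T.continuousLinearMapAt_symmL hx w
    constructor
    · rw [hAs]
      exact ((T.symmL ℝ x ∘L T.continuousLinearMapAt ℝ y).le_opNorm v).trans
        (mul_le_mul_of_nonneg_right h1.le (norm_nonneg _))
    · have h3 := ((T.symmL ℝ y ∘L T.continuousLinearMapAt ℝ x).le_opNorm
        (A.symm (T.continuousLinearMapAt ℝ y v))).trans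
          (mul_le_mul_of_nonneg_right h2.le (norm_nonneg _))
      have h4 : (T.symmL ℝ y ∘L T.continuousLinearMapAt ℝ x)
          (A.symm (T.continuousLinearMapAt ℝ y v)) = v := by
        rw [ContinuousLinearMap.comp_apply, hAs, hA]
        exact T.symmL_continuousLinearMapAt hyT v
      rwa [h4] at h3

end Charts

/-! ### Charts that are almost isometric near a point -/

section Radius

open MeasureTheory

variable {c : ℕ} {M : Type*} [EMetricSpace M] [ChartedSpace (EuclideanSpace ℝ (Fin c)) M]
  [RiemannianBundle (fun x : M => TangentSpace (𝓡 c) x)]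

/-- Quantitative control of a chart `e` centred at `x` on the ball of radius `3 * R` of its
target: the derivative of `e` distorts norms by a factor at most `q`, and `e` is `4`-bi-Lipschitz.
Moreover the points at distance less than `ρ` from `x` are mapped into the ball of radius `R`. -/
structure IsControlled {s u : ℕ} (x : M) (e : OpenPartialHomeomorph M (SplitSpace s u))
    (q R ρ : ℝ) : Prop where
  radius_pos : 0 < R
  ρ_pos : 0 < ρ
  closedBall_subset : Metric.closedBall 0 (3 * R) ⊆ e.target
  le_mul_norm : ∀ y ∈ e.source, ‖e y‖ ≤ 3 * R → ∀ v : TangentSpace (𝓡 c) y,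
    l2norm (vectorDeriv (c := c) e y v) ≤ q * ‖v‖
  norm_le_mul : ∀ y ∈ e.source, ‖e y‖ ≤ 3 * R → ∀ v : TangentSpace (𝓡 c) y,
    ‖v‖ ≤ q * l2norm (vectorDeriv (c := c) e y v)
  edist_le : ∀ y ∈ e.source, ∀ z ∈ e.source, ‖e y‖ ≤ 3 * R → ‖e z‖ ≤ 3 * R →
    edist y z ≤ ENNReal.ofReal (4 * ‖e y - e z‖)
  le_edist : ∀ y ∈ e.source, ∀ z ∈ e.source, ‖e y‖ ≤ 3 * R → ‖e z‖ ≤ 3 * R →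
    ENNReal.ofReal ‖e y - e z‖ ≤ 4 * edist y z
  near : ∀ y, edist x y < ENNReal.ofReal ρ → y ∈ e.source ∧ ‖e y‖ < R

variable [IsRiemannianManifold (𝓡 c) M]

/-- The inverse of a chart is Lipschitz on convex sets where its derivative is bounded: the
preimage of the segment between two points is a short path. -/
theorem edist_le_of_segment {s u : ℕ} {e : OpenPartialHomeomorph M (SplitSpace s u)}
    (he : ContMDiffOn (𝓡 c) 𝓘(ℝ, SplitSpace s u) ∞ e e.source)
    (he' : ContMDiffOn 𝓘(ℝ, SplitSpace s u) (𝓡 c) ∞ e.symm e.target)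
    {V : Set (SplitSpace s u)} (hV : Convex ℝ V) (hVt : V ⊆ e.target)
    (h : ∀ w ∈ V, ∀ v : TangentSpace (𝓡 c) (e.symm w),
      ‖v‖ ≤ 2 * l2norm (vectorDeriv (c := c) e (e.symm w) v))
    {y z : M} (hy : y ∈ e.source) (hz : z ∈ e.source) (hyV : e y ∈ V) (hzV : e z ∈ V) :
    edist y z ≤ ENNReal.ofReal (4 * ‖e y - e z‖) := by
  let l : ℝ → SplitSpace s u := fun t => e y + t • (e z - e y)
  have hl : ∀ t ∈ Icc (0 : ℝ) 1, l t ∈ V := fun t ht => hV.add_smul_sub_mem hyV hzV ht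
  have hld : ∀ t, HasDerivAt l (e z - e y) t := fun t => by
    simpa [l] using (((hasDerivAt_id t).smul_const (e z - e y)).const_add (e y) :)
  have hls : ContDiff ℝ 1 l := contDiff_const.add (contDiff_id.smul contDiff_const)
  let p : ℝ → M := e.symm ∘ l
  have hp : ContMDiffOn 𝓘(ℝ, ℝ) (𝓡 c) 1 p (Icc 0 1) :=
    (he'.of_le (by norm_num)).comp hls.contMDiff.contMDiffOn fun t ht => hVt (hl t ht)
  have hps : ∀ t ∈ Icc (0 : ℝ) 1, p t ∈ e.source := fun t ht => e.map_target (hVt (hl t ht))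
  rw [IsRiemannianManifold.out (I := 𝓡 c)]
  refine (Manifold.riemannianEDist_le_pathELength hp (x := y) (y := z) ?_ ?_ zero_le_one).trans ?_
  · simp [p, l, hy]
  · simp [p, l, hz]
  rw [Manifold.pathELength_eq_lintegral_mfderivWithin_Icc]
  have key : ∀ t ∈ Icc (0 : ℝ) 1, ‖mfderivWithin 𝓘(ℝ, ℝ) (𝓡 c) p (Icc 0 1) t 1‖ₑ
      ≤ ENNReal.ofReal (4 * ‖e y - e z‖) := by
    intro t ht
    have hd : mfderivWithin 𝓘(ℝ, ℝ) 𝓘(ℝ, SplitSpace s u) (e ∘ p) (Icc 0 1) t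
        = (mfderiv (𝓡 c) 𝓘(ℝ, SplitSpace s u) e (p t)).comp
          (mfderivWithin 𝓘(ℝ, ℝ) (𝓡 c) p (Icc 0 1) t) := by
      apply mfderiv_comp_mfderivWithin
      · exact (he.contMDiffAt (e.open_source.mem_nhds (hps t ht))).mdifferentiableAt (by simp)
      · exact hp.mdifferentiableOn one_ne_zero t ht
      · rw [uniqueMDiffWithinAt_iff_uniqueDiffWithinAt]
        exact uniqueDiffOn_Icc zero_lt_one _ ht
    have h1 : derivWithin (e ∘ p) (Icc 0 1) t
        = vectorDeriv (c := c) e (p t) (mfderivWithin 𝓘(ℝ, ℝ) (𝓡 c) p (Icc 0 1) t 1) := by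
      rw [← fderivWithin_derivWithin, ← mfderivWithin_eq_fderivWithin, hd]
      rfl
    have h2 : derivWithin (e ∘ p) (Icc 0 1) t = e z - e y := by
      have : EqOn (e ∘ p) l (Icc 0 1) := fun t ht => e.right_inv (hVt (hl t ht))
      rw [derivWithin_congr this (this ht)]
      exact (hld t).hasDerivWithinAt.derivWithin (uniqueDiffOn_Icc zero_lt_one _ ht)
    rw [← ofReal_norm]
    refine ENNReal.ofReal_le_ofReal ((h (l t) (hl t ht) _).trans ?_)
    have h3 := l2norm_le_two_mul (e z - e y)
    rw [norm_sub_rev] at h3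
    change 2 * l2norm (vectorDeriv (c := c) e (p t) _) ≤ _
    rw [← h1, h2]
    linarith
  refine (setLIntegral_mono' measurableSet_Icc key).trans ?_
  simp

/-- A chart is `2`-Lipschitz for the Riemannian distance on a ball, if its derivative has norm at
most `2` on the concentric ball of radius three times as large: the almost minimizing paths stay in
the larger ball. -/
theorem ofReal_norm_sub_le_two_mul_edist {F : Type*} [NormedAddCommGroup F] [NormedSpace ℝ F]
    [CompleteSpace F] {f : M → F} {x : M} {ρ : ℝ≥0∞}
    (hf : ContMDiffOn (𝓡 c) 𝓘(ℝ, F) 1 f (Metric.eball x (3 * ρ)))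
    (h : ∀ y ∈ Metric.eball x (3 * ρ), ∀ v : TangentSpace (𝓡 c) y,
      ‖vectorDeriv f y v‖ ≤ 2 * ‖v‖)
    {y z : M} (hy : edist x y < ρ) (hz : edist x z < ρ) :
    ENNReal.ofReal ‖f y - f z‖ ≤ 2 * edist y z := by
  have hyz : edist y z < 2 * ρ := by
    calc edist y z ≤ edist y x + edist x z := edist_triangle _ _ _
      _ < ρ + ρ := by rw [edist_comm y x]; exact ENNReal.add_lt_add hy hz
      _ = 2 * ρ := (two_mul _).symm
  have key : ∀ b, edist y z < b → b ≤ 2 * ρ → ENNReal.ofReal ‖f y - f z‖ ≤ 2 * b := by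
    intro b hb hbρ
    obtain ⟨p, h0, h1, hp, hl⟩ := exists_path_of_edist_lt (c := c) hb
    have hpU : ∀ t ∈ Icc (0 : ℝ) 1, p t ∈ Metric.eball x (3 * ρ) := by
      intro t ht
      rw [Metric.mem_eball, edist_comm]
      calc edist x (p t) ≤ edist x y + edist y (p t) := edist_triangle _ _ _
        _ < ρ + 2 * ρ := by
            refine ENNReal.add_lt_add hy ?_
            rw [← h0]
            exact (edist_le_pathELength (c := c) hp ht).trans_lt (hl.trans_le hbρ)
        _ = 3 * ρ := by ring
    have := enorm_sub_le_mul_pathELength Metric.isOpen_eball hf zero_le_two h hp hpU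
    rw [h0, h1, ← ofReal_norm, norm_sub_rev] at this
    refine this.trans ?_
    rw [ENNReal.ofReal_ofNat]
    gcongr
  rw [mul_comm, ← ENNReal.div_le_iff_le_mul (by simp) (by simp)]
  refine le_of_forall_gt_imp_ge_of_dense fun b hb => ?_
  rw [ENNReal.div_le_iff_le_mul (by simp) (by simp), mul_comm]
  exact (key (min b (2 * ρ)) (lt_min hb hyz) (min_le_right _ _)).trans
    (by gcongr; exact min_le_left _ _)

/-- A chart that is an isometry at `x` is controlled on a small ball. Capping the distortion at `2`
makes the constant `4` of the bi-Lipschitz bounds available for every `q`. -/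
theorem IsNormalizedChart.exists_isControlled {s u : ℕ} {x : M}
    {e : OpenPartialHomeomorph M (SplitSpace s u)} (he : IsNormalizedChart (c := c) x e) {q : ℝ}
    (hq : 1 < q) : ∃ R ρ, IsControlled (c := c) x e q R ρ := by
  have hq2 : 1 < min q 2 := lt_min hq one_lt_two
  have hev := (he.eventually_distortion _ hq2).and (e.open_source.mem_nhds he.mem_source)
  -- the distortion is controlled on the ball of radius `ρ₁`; the points used later lie in the ball
  -- of radius `ρ₁ / 3`, so that almost minimizing paths between them do not leave the former ball
  obtain ⟨ρ₁, hρ₁, hsub⟩ := EMetric.mem_nhds_iff.1 hev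
  have hdiv : 3 * (ρ₁ / 3) = ρ₁ := ENNReal.mul_div_cancel (by simp) (by simp)
  have h3 : ρ₁ / 3 ≤ ρ₁ := ENNReal.div_le_of_le_mul (le_mul_of_one_le_right' (by norm_num))
  have hpos : 0 < ρ₁ / 3 := ENNReal.div_pos hρ₁.ne' (by simp)
  have h0 : (0 : SplitSpace s u) ∈ e.target := he.map_base ▸ e.map_source he.mem_source
  have hs0 : e.symm 0 = x := by rw [← he.map_base, e.left_inv he.mem_source]
  have hT : e.target ∩ e.symm ⁻¹' Metric.eball x (ρ₁ / 3) ∈ 𝓝 (0 : SplitSpace s u) := by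
    refine inter_mem (e.open_target.mem_nhds h0) ?_
    refine (e.continuousAt_symm h0).preimage_mem_nhds ?_
    rw [hs0]
    exact Metric.eball_mem_nhds _ hpos
  obtain ⟨R₀, hR₀, hball⟩ := Metric.mem_nhds_iff.1 hT
  have hcb : Metric.closedBall (0 : SplitSpace s u) (3 * (R₀ / 4)) ⊆ Metric.ball 0 R₀ :=
    Metric.closedBall_subset_ball (by linarith)
  have hmem : ∀ y ∈ e.source, ‖e y‖ ≤ 3 * (R₀ / 4) → edist x y < ρ₁ / 3 := by
    intro y hy hn
    have := (hball (hcb (by simpa using hn : e y ∈ _))).2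
    rw [mem_preimage, e.left_inv hy, Metric.mem_eball, edist_comm] at this
    exact this
  have hmem' : ∀ y ∈ e.source, ‖e y‖ ≤ 3 * (R₀ / 4) → y ∈ Metric.eball x ρ₁ := by
    intro y hy hn
    rw [Metric.mem_eball, edist_comm]
    exact (hmem y hy hn).trans_le h3
  have hU : {y | y ∈ e.source ∧ ‖e y‖ < R₀ / 4} ∈ 𝓝 x := by
    refine inter_mem (e.open_source.mem_nhds he.mem_source) ?_
    have := (e.continuousAt he.mem_source).norm
    refine this.eventually_lt_const ?_
    simpa [he.map_base] using hR₀
  obtain ⟨ρ₂, hρ₂, hsub₂⟩ := EMetric.mem_nhds_iff.1 hU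
  obtain ⟨ρ, hρ0, hρ⟩ := ENNReal.lt_iff_exists_real_btwn.1 hρ₂
  refine ⟨R₀ / 4, ρ, by positivity, ?_, fun w hw => (hball (hcb hw)).1, ?_, ?_, ?_, ?_, ?_⟩
  · simpa using hρ.1
  · intro y hy hn v
    refine ((hsub (hmem' y hy hn)).1 v).1.trans ?_
    gcongr; exact min_le_left _ _
  · intro y hy hn v
    refine ((hsub (hmem' y hy hn)).1 v).2.trans ?_
    gcongr
    · exact norm_nonneg _
    · exact min_le_left _ _
  · intro y hy z hz hyn hzn
    refine edist_le_of_segment he.contMDiffOn he.contMDiffOn_symm (convex_closedBall 0 (3 * (R₀ / 4)))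
      (fun w hw => (hball (hcb hw)).1) ?_ hy hz (by simpa using hyn) (by simpa using hzn)
    intro w hw v
    have hwt := (hball (hcb hw)).1
    refine ((hsub (hmem' (e.symm w) (e.map_target hwt) ?_)).1 v).2.trans ?_
    · rw [e.right_inv hwt]; simpa using hw
    · gcongr
      · exact norm_nonneg _
      · exact min_le_right _ _
  · intro y hy z hz hyn hzn
    refine (ofReal_norm_sub_le_two_mul_edist (c := c) (f := e) (x := x) (ρ := ρ₁ / 3) ?_ ?_
      (hmem y hy hyn) (hmem z hz hzn)).trans ?_
    · rw [hdiv]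
      exact (he.contMDiffOn.of_le (by norm_num)).mono fun y hy => (hsub hy).2
    · rw [hdiv]
      intro y hy v
      refine (norm_le_l2norm _).trans (((hsub hy).1 v).1.trans ?_)
      gcongr; exact min_le_right _ _
    · gcongr; norm_num
  · intro y hy
    apply hsub₂
    rw [Metric.mem_eball, edist_comm]
    exact hy.trans hρ.2

end Radius

/-! ### Diffeomorphisms supported in a chart -/

section Extension

open Classical in
/-- The self-map of `M` that is `g` read in the chart `e`, and the identity outside the domain of
the chart. -/
noncomputable def extendByChart {M F : Type*} [TopologicalSpace M] [TopologicalSpace F]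
    (e : OpenPartialHomeomorph M F) (g : F → F) (y : M) : M :=
  if y ∈ e.source then e.symm (g (e y)) else y

/-- An injective map that is the identity outside `K` cannot map a point of `K` to a point outside
`K`. -/
theorem mapsTo_target_of_injective {F : Type*} {g : F → F} (hg : g.Injective) {K T : Set F}
    (hKT : K ⊆ T) (hK : ∀ w, w ∉ K → g w = w) : MapsTo g T T := by
  intro w hw
  by_cases h : w ∈ K
  · by_contra hn
    have h1 := hK (g w) fun h' => hn (hKT h')
    rw [hg h1] at hn
    exact hn hw
  · rwa [hK w h]

variable {F : Type*} [NormedAddCommGroup F] {M : Type*} [EMetricSpace M]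

theorem extendByChart_of_mem {e : OpenPartialHomeomorph M F} {g : F → F} {y : M}
    (hy : y ∈ e.source) : extendByChart e g y = e.symm (g (e y)) := if_pos hy

theorem extendByChart_of_notMem {e : OpenPartialHomeomorph M F} {g : F → F} {y : M}
    (hy : y ∉ e.source) : extendByChart e g y = y := if_neg hy

/-- If `g` is the identity outside `K`, the extension is the identity outside the preimage of
`K`. -/
theorem extendByChart_eq_self {e : OpenPartialHomeomorph M F} {g : F → F} {K : Set F}
    (hK : ∀ w, w ∉ K → g w = w) {y : M} (hy : y ∉ e.symm '' K) : extendByChart e g y = y := by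
  by_cases h : y ∈ e.source
  · rw [extendByChart_of_mem h, hK _ fun h' => hy ⟨_, h', e.left_inv h⟩, e.left_inv h]
  · exact extendByChart_of_notMem h

theorem isClosed_symm_image {e : OpenPartialHomeomorph M F} {K : Set F} (hKc : IsCompact K)
    (hKt : K ⊆ e.target) : IsClosed (e.symm '' K) :=
  (hKc.image_of_continuousOn (e.continuousOn_symm.mono hKt)).isClosed

theorem extendByChart_comp {e : OpenPartialHomeomorph M F} {g g' : F → F}
    (hg : MapsTo g e.target e.target) (h : ∀ w, g' (g w) = w) (y : M) :
    extendByChart e g' (extendByChart e g y) = y := by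
  by_cases hy : y ∈ e.source
  · have h1 := hg (e.map_source hy)
    rw [extendByChart_of_mem hy, extendByChart_of_mem (e.map_target h1), e.right_inv h1, h,
      e.left_inv hy]
  · rw [extendByChart_of_notMem hy, extendByChart_of_notMem hy]

variable [NormedSpace ℝ F] {c : ℕ} [ChartedSpace (EuclideanSpace ℝ (Fin c)) M]

/-- A family of maps of the chart domain that is jointly smooth and is supported in a fixed compact
set extends to a jointly smooth family of maps of the manifold. -/
theorem contMDiffAt_extendByChart {e : OpenPartialHomeomorph M F}
    (he : ContMDiffOn (𝓡 c) 𝓘(ℝ, F) ∞ e e.source)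
    (he' : ContMDiffOn 𝓘(ℝ, F) (𝓡 c) ∞ e.symm e.target)
    {g : ℝ → F → F} (hg : ContDiff ℝ ∞ (fun p : ℝ × F => g p.1 p.2)) {K : Set F}
    (hKc : IsCompact K) (hKt : K ⊆ e.target) (hK : ∀ θ w, w ∉ K → g θ w = w) {θ₀ : ℝ}
    (hmaps : MapsTo (g θ₀) e.target e.target) (y₀ : M) :
    ContMDiffAt (𝓘(ℝ, ℝ).prod (𝓡 c)) (𝓡 c) ∞
      (fun p : ℝ × M => extendByChart e (g p.1) p.2) (θ₀, y₀) := by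
  by_cases hy : y₀ ∈ e.source
  · have h1 : ContMDiffAt (𝓘(ℝ, ℝ).prod (𝓡 c)) 𝓘(ℝ, F) ∞ (fun p : ℝ × M => e p.2) (θ₀, y₀) :=
      (he.contMDiffAt (e.open_source.mem_nhds hy)).comp (θ₀, y₀) contMDiffAt_snd
    have h2 : ContMDiffAt (𝓘(ℝ, ℝ).prod (𝓡 c)) 𝓘(ℝ, ℝ × F) ∞
        (fun p : ℝ × M => (p.1, e p.2)) (θ₀, y₀) := by
      exact contMDiffAt_fst.prodMk_space h1
    have h3 : ContMDiffAt (𝓘(ℝ, ℝ).prod (𝓡 c)) 𝓘(ℝ, F) ∞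
        (fun p : ℝ × M => g p.1 (e p.2)) (θ₀, y₀) :=
      (hg.contMDiff.contMDiffAt).comp (θ₀, y₀) h2
    have h4 : g θ₀ (e y₀) ∈ e.target := hmaps (e.map_source hy)
    have h5 := (he'.contMDiffAt (e.open_target.mem_nhds h4)).comp (θ₀, y₀) h3
    refine h5.congr_of_eventuallyEq ?_
    have : ∀ᶠ p : ℝ × M in 𝓝 (θ₀, y₀), p.2 ∈ e.source :=
      continuousAt_snd.preimage_mem_nhds (e.open_source.mem_nhds hy)
    filter_upwards [this] with p hp
    exact extendByChart_of_mem hp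
  · have hy' : y₀ ∉ e.symm '' K := by
      rintro ⟨w, hw, rfl⟩
      exact hy (e.map_target (hKt hw))
    refine (contMDiffAt_snd (n := ∞)).congr_of_eventuallyEq ?_
    have : ∀ᶠ p : ℝ × M in 𝓝 (θ₀, y₀), p.2 ∉ e.symm '' K :=
      continuousAt_snd.preimage_mem_nhds
        ((isClosed_symm_image hKc hKt).isOpen_compl.mem_nhds
          (show y₀ ∈ (e.symm '' K)ᶜ from hy'))
    filter_upwards [this] with p hp
    exact extendByChart_eq_self (hK _) hp

theorem contMDiff_extendByChart {e : OpenPartialHomeomorph M F}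
    (he : ContMDiffOn (𝓡 c) 𝓘(ℝ, F) ∞ e e.source)
    (he' : ContMDiffOn 𝓘(ℝ, F) (𝓡 c) ∞ e.symm e.target)
    {g : F → F} (hg : ContDiff ℝ ∞ g) (hinj : g.Injective) {K : Set F}
    (hKc : IsCompact K) (hKt : K ⊆ e.target) (hK : ∀ w, w ∉ K → g w = w) :
    ContMDiff (𝓡 c) (𝓡 c) ∞ (extendByChart e g) := fun y =>
  (contMDiffAt_extendByChart he he' (g := fun _ => g) (hg.comp contDiff_snd) hKc hKt
    (fun _ => hK) (θ₀ := 0) (mapsTo_target_of_injective hinj hKt hK) y).comp y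
    (contMDiffAt_const.prodMk contMDiffAt_id)

/-- The diffeomorphism of `M` that is the diffeomorphism `g` read in the chart `e`, where `g` is
supported in a compact subset `K` of the target of `e`. -/
noncomputable def chartDiffeomorph {e : OpenPartialHomeomorph M F}
    (he : ContMDiffOn (𝓡 c) 𝓘(ℝ, F) ∞ e e.source)
    (he' : ContMDiffOn 𝓘(ℝ, F) (𝓡 c) ∞ e.symm e.target) {K : Set F}
    (hKc : IsCompact K) (hKt : K ⊆ e.target)
    (g : F ≃ F) (hg : ContDiff ℝ ∞ g) (hg' : ContDiff ℝ ∞ g.symm)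
    (hK : ∀ w, w ∉ K → g w = w) (r : ℕ∞) : M ≃ₘ^r⟮𝓡 c, 𝓡 c⟯ M where
  toFun := extendByChart e g
  invFun := extendByChart e g.symm
  left_inv := extendByChart_comp (mapsTo_target_of_injective g.injective hKt hK)
    g.symm_apply_apply
  right_inv := extendByChart_comp (mapsTo_target_of_injective g.symm.injective hKt
    fun w hw => by rw [Equiv.symm_apply_eq, hK w hw]) g.apply_symm_apply
  contMDiff_toFun :=
    (contMDiff_extendByChart he he' hg g.injective hKc hKt hK).of_le (by exact_mod_cast le_top)
  contMDiff_invFun :=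
    (contMDiff_extendByChart he he' hg' g.symm.injective hKc hKt
      fun w hw => by rw [Equiv.symm_apply_eq, hK w hw]).of_le (by exact_mod_cast le_top)

/-- The derivative, read in the chart `e`, of a map that is `G` in this chart. -/
theorem vectorDeriv_mfderiv {e : OpenPartialHomeomorph M F}
    (he : ContMDiffOn (𝓡 c) 𝓘(ℝ, F) ∞ e e.source) {f : M → M} {G : F → F} {y : M}
    (hf : MDifferentiableAt (𝓡 c) (𝓡 c) f y) (hy : y ∈ e.source) (hfy : f y ∈ e.source)
    (hG : DifferentiableAt ℝ G (e y)) (h : (e ∘ f : M → F) =ᶠ[𝓝 y] G ∘ e)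
    (v : TangentSpace (𝓡 c) y) :
    vectorDeriv (c := c) e (f y) (mfderiv (𝓡 c) (𝓡 c) f y v)
      = fderiv ℝ G (e y) (vectorDeriv (c := c) e y v) := by
  have hey : ∀ z ∈ e.source, MDifferentiableAt (𝓡 c) 𝓘(ℝ, F) e z := fun z hz =>
    (he.contMDiffAt (e.open_source.mem_nhds hz)).mdifferentiableAt (by simp)
  have h1 : mfderiv (𝓡 c) 𝓘(ℝ, F) (e ∘ f) y
      = (mfderiv (𝓡 c) 𝓘(ℝ, F) e (f y)).comp (mfderiv (𝓡 c) (𝓡 c) f y) :=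
    mfderiv_comp y (hey _ hfy) hf
  have h2 : mfderiv (𝓡 c) 𝓘(ℝ, F) (G ∘ e) y
      = (mfderiv 𝓘(ℝ, F) 𝓘(ℝ, F) G (e y)).comp (mfderiv (𝓡 c) 𝓘(ℝ, F) e y) :=
    mfderiv_comp y hG.mdifferentiableAt (hey _ hy)
  have h3 := h.mfderiv_eq (I := 𝓡 c) (I' := 𝓘(ℝ, F))
  have h4 : (mfderiv (𝓡 c) 𝓘(ℝ, F) (e ∘ f) y v : F) = (mfderiv (𝓡 c) 𝓘(ℝ, F) (G ∘ e) y v : F) := by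
    rw [h3]; rfl
  rw [h1, h2, mfderiv_eq_fderiv] at h4
  exact h4

end Extension

/-! ### Continuity of jets in a parameter -/

section Arcs

/-- The partial derivatives of a jointly smooth map in one of its variables are jointly
continuous. -/
theorem continuousAt_iteratedFDeriv_snd {P E F : Type*} [NormedAddCommGroup P] [NormedSpace ℝ P]
    [NormedAddCommGroup E] [NormedSpace ℝ E] [NormedAddCommGroup F] [NormedSpace ℝ F]
    {H : P × E → F} {p₀ : P × E} (h : ContDiffAt ℝ ∞ H p₀) (m : ℕ) :
    ContinuousAt (fun p : P × E => iteratedFDeriv ℝ m (fun v => H (p.1, v)) p.2) p₀ := by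
  have hm : ContDiffAt ℝ m H p₀ := h.of_le (by exact_mod_cast le_top)
  obtain ⟨U, hU, hHU⟩ : ∃ U ∈ 𝓝 p₀, ContDiffOn ℝ m H U :=
    hm.contDiffOn le_rfl (by simp)
  obtain ⟨V, hVU, hVo, hpV⟩ := mem_nhds_iff.1 hU
  have key : ∀ p ∈ V, iteratedFDeriv ℝ m (fun v => H (p.1, v)) p.2
      = (iteratedFDeriv ℝ m H p).compContinuousLinearMap
        fun _ => ContinuousLinearMap.inr ℝ P E := by
    intro p hp
    let a : P × E := (p.1, 0)
    let Va : Set (P × E) := (fun w => a + w) ⁻¹' V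
    have hVa : IsOpen Va := hVo.preimage (continuous_const_add a)
    have hin : (p.2 : E) ∈ ContinuousLinearMap.inr ℝ P E ⁻¹' Va := by
      simpa [Va, a] using hp
    have hcd : ContDiffOn ℝ m (fun w => H (a + w)) Va :=
      (hHU.mono hVU).comp (contDiff_const.add contDiff_id).contDiffOn fun w hw => hw
    have hVi : IsOpen (ContinuousLinearMap.inr ℝ P E ⁻¹' Va) :=
      hVa.preimage (ContinuousLinearMap.inr ℝ P E).continuous
    have := (ContinuousLinearMap.inr ℝ P E).iteratedFDerivWithin_comp_right hcd
      hVa.uniqueDiffOn hVi.uniqueDiffOn hin (le_refl (m : ℕ∞ω))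
    rw [iteratedFDerivWithin_of_isOpen m hVi hin, iteratedFDerivWithin_of_isOpen m hVa hin,
      iteratedFDeriv_comp_add_left] at this
    have h1 : ((fun w => H (a + w)) ∘ ContinuousLinearMap.inr ℝ P E) = fun v => H (p.1, v) := by
      ext v; simp [a]
    have h2 : a + ContinuousLinearMap.inr ℝ P E p.2 = p := by simp [a]
    rw [h1, h2] at this
    exact this
  have hc : ContinuousAt (fun p => (iteratedFDeriv ℝ m H p).compContinuousLinearMap
      fun _ => ContinuousLinearMap.inr ℝ P E) p₀ :=
    (ContinuousMultilinearMap.compContinuousLinearMapL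
      (fun _ : Fin m => ContinuousLinearMap.inr ℝ P E)).continuous.continuousAt.comp
      (hm.continuousAt_iteratedFDeriv le_rfl)
  refine hc.congr ?_
  filter_upwards [hVo.mem_nhds hpV] with p hp
  exact (key p hp).symm

variable {c : ℕ} {M : Type*} [EMetricSpace M] [ChartedSpace (EuclideanSpace ℝ (Fin c)) M]
  [IsManifold (𝓡 c) ∞ M]

/-- A continuous reparametrization of a jointly smooth family of maps is continuous in
the compact-open `C^r` topology. -/
theorem continuousAt_iteratedFDeriv_of_contMDiffAt {Ψ : ℝ × M → M} {ϑ : ℝ≥0 → ℝ}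
    (hϑ : Continuous ϑ) (ε₀ : ℝ≥0) (y₀ : M)
    (hΨ : ContMDiffAt (𝓘(ℝ, ℝ).prod (𝓡 c)) (𝓡 c) ∞ Ψ (ϑ ε₀, y₀)) (m : ℕ) :
    ContinuousAt
      (fun p : ℝ≥0 × EuclideanSpace ℝ (Fin c) =>
        iteratedFDeriv ℝ m
          (fun v => extChartAt (𝓡 c) (Ψ (ϑ ε₀, y₀))
            (Ψ (ϑ p.1, (extChartAt (𝓡 c) y₀).symm v))) p.2)
      (ε₀, extChartAt (𝓡 c) y₀ y₀) := by
  let E := EuclideanSpace ℝ (Fin c)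
  let H : ℝ × E → E := fun q =>
    extChartAt (𝓡 c) (Ψ (ϑ ε₀, y₀)) (Ψ (q.1, (extChartAt (𝓡 c) y₀).symm q.2))
  have hsymm : ContMDiffAt 𝓘(ℝ, E) (𝓡 c) ∞ (extChartAt (𝓡 c) y₀).symm (extChartAt (𝓡 c) y₀ y₀) :=
    (contMDiffOn_extChartAt_symm y₀).contMDiffAt (extChartAt_target_mem_nhds y₀)
  have h0 : (extChartAt (𝓡 c) y₀).symm (extChartAt (𝓡 c) y₀ y₀) = y₀ := extChartAt_to_inv y₀
  have h1 : ContMDiffAt 𝓘(ℝ, ℝ × E) (𝓘(ℝ, ℝ).prod (𝓡 c)) ∞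
      (fun q : ℝ × E => (q.1, (extChartAt (𝓡 c) y₀).symm q.2))
      (ϑ ε₀, extChartAt (𝓡 c) y₀ y₀) :=
    contDiffAt_fst.contMDiffAt.prodMk
      (hsymm.comp (ϑ ε₀, extChartAt (𝓡 c) y₀ y₀) contDiffAt_snd.contMDiffAt)
  have h2 : ContMDiffAt 𝓘(ℝ, ℝ × E) (𝓡 c) ∞
      (fun q : ℝ × E => Ψ (q.1, (extChartAt (𝓡 c) y₀).symm q.2))
      (ϑ ε₀, extChartAt (𝓡 c) y₀ y₀) :=
    ContMDiffAt.comp (g := Ψ) (ϑ ε₀, extChartAt (𝓡 c) y₀ y₀) (by simpa only [h0] using hΨ) h1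
  have h3 : ContMDiffAt 𝓘(ℝ, ℝ × E) 𝓘(ℝ, E) ∞ H (ϑ ε₀, extChartAt (𝓡 c) y₀ y₀) := by
    refine ContMDiffAt.comp (g := extChartAt (𝓡 c) (Ψ (ϑ ε₀, y₀))) _ ?_ h2
    simp only [h0]
    exact contMDiffAt_extChartAt
  have h4 := continuousAt_iteratedFDeriv_snd h3.contDiffAt m
  have h5 : ContinuousAt (fun p : ℝ≥0 × E => (ϑ p.1, p.2)) (ε₀, extChartAt (𝓡 c) y₀ y₀) := by
    fun_prop
  exact ContinuousAt.comp (x := (ε₀, extChartAt (𝓡 c) y₀ y₀))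
    (g := fun p : ℝ × E => iteratedFDeriv ℝ m (fun v => H (p.1, v)) p.2) h4 h5

end Arcs

/-! ### Cut-off saddle maps -/

section Family

/-- A smooth self-map of a Banach space that is `C^1`-close to the identity is a diffeomorphism. -/
theorem exists_equiv_of_norm_fderiv_sub_id_le {F : Type*} [NormedAddCommGroup F] [NormedSpace ℝ F]
    [CompleteSpace F] {f : F → F} (hf : ContDiff ℝ ∞ f)
    (h : ∀ w, ‖fderiv ℝ f w - ContinuousLinearMap.id ℝ F‖ ≤ 1 / 2) :
    ∃ g : F ≃ F, ⇑g = f ∧ ContDiff ℝ ∞ g.symm := by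
  have hd : Differentiable ℝ f := hf.differentiable (by simp)
  have hlip : LipschitzWith (1 / 2) fun w => f w - w := by
    refine lipschitzWith_of_nnnorm_fderiv_le (𝕜 := ℝ) (hd.sub differentiable_id) fun w => ?_
    have : fderiv ℝ (fun w => f w - w) w = fderiv ℝ f w - ContinuousLinearMap.id ℝ F :=
      ((hd w).hasFDerivAt.sub (hasFDerivAt_id w)).fderiv
    rw [this, ← NNReal.coe_le_coe]
    simpa using h w
  have happ : ApproximatesLinearOn f
      ((ContinuousLinearEquiv.refl ℝ F : F ≃L[ℝ] F) : F →L[ℝ] F) univ (1 / 2) := by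
    rw [ApproximatesLinearOn.eq_def]
    intro x _ y _
    have := hlip.norm_sub_le x y
    simpa [sub_sub_sub_comm] using this
  have hc : Subsingleton F ∨
      (1 / 2 : ℝ≥0) < ‖((ContinuousLinearEquiv.refl ℝ F).symm : F →L[ℝ] F)‖₊⁻¹ := by
    rcases subsingleton_or_nontrivial F with hF | hF
    · exact Or.inl hF
    · right
      have : ‖((ContinuousLinearEquiv.refl ℝ F).symm : F →L[ℝ] F)‖₊ = 1 := by
        rw [← NNReal.coe_inj]; exact ContinuousLinearMap.norm_id
      rw [this, inv_one]
      rw [← NNReal.coe_lt_coe]; norm_num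
  let e : F ≃ₜ F := happ.toHomeomorph f hc
  have he : ⇑e = f := rfl
  have hder : ∀ w, ∃ L : F ≃L[ℝ] F, (L : F →L[ℝ] F) = fderiv ℝ f w := by
    intro w
    have hlt : ‖-(fderiv ℝ f w - ContinuousLinearMap.id ℝ F)‖ < 1 := by
      rw [norm_neg]; exact (h w).trans_lt (by norm_num)
    refine ⟨ContinuousLinearEquiv.unitsEquiv ℝ F (Units.oneSub _ hlt), ?_⟩
    ext v
    change ((Units.oneSub _ hlt : (F →L[ℝ] F)ˣ) : F →L[ℝ] F) v = _
    simp [Units.val_oneSub]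
  choose L hL using hder
  refine ⟨e.toEquiv, he, ?_⟩
  exact e.contDiff_symm (f₀' := L) (fun w => by rw [hL]; exact (hd w).hasFDerivAt) hf

variable {s u : ℕ}

/-- The linear vector field `(p, q) ↦ (-p, q)`, contracting on `ℝ^s` and expanding on `ℝ^u`. -/
def saddle (s u : ℕ) : SplitSpace s u →L[ℝ] SplitSpace s u :=
  (-ContinuousLinearMap.fst ℝ _ _).prod (ContinuousLinearMap.snd ℝ _ _)

/-- The affine saddle map `w ↦ w + θ • (saddle w + (θ / 4) • v)`, with rates `1 - θ` and `1 + θ`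
and a translation part of order `θ ^ 2`. -/
noncomputable def affineSaddle (θ : ℝ) (v w : SplitSpace s u) : SplitSpace s u :=
  w + θ • (saddle s u w + (θ / 4) • v)

/-- The affine saddle map, cut off by the bump function `χ`. -/
noncomputable def cutoffSaddle (χ : ContDiffBump (0 : SplitSpace s u)) (v : SplitSpace s u) (θ : ℝ)
    (w : SplitSpace s u) : SplitSpace s u :=
  w + (θ * χ w) • (saddle s u w + (θ / 4) • v)

theorem contDiff_cutoffSaddle (χ : ContDiffBump (0 : SplitSpace s u)) (v : SplitSpace s u) :
    ContDiff ℝ ∞ (fun p : ℝ × SplitSpace s u => cutoffSaddle χ v p.1 p.2) := by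
  have h1 : ContDiff ℝ ∞ (fun p : ℝ × SplitSpace s u => χ p.2) := χ.contDiff.comp contDiff_snd
  have h2 : ContDiff ℝ ∞ (fun p : ℝ × SplitSpace s u => saddle s u p.2) :=
    (saddle s u).contDiff.comp contDiff_snd
  unfold cutoffSaddle
  exact contDiff_snd.add ((contDiff_fst.mul h1).smul
    (h2.add ((contDiff_fst.div_const 4).smul contDiff_const)))

theorem cutoffSaddle_zero (χ : ContDiffBump (0 : SplitSpace s u)) (v w : SplitSpace s u) :
    cutoffSaddle χ v 0 w = w := by simp [cutoffSaddle]

theorem cutoffSaddle_of_notMem (χ : ContDiffBump (0 : SplitSpace s u)) (v : SplitSpace s u) (θ : ℝ)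
    {w : SplitSpace s u} (hw : w ∉ Metric.closedBall 0 χ.rOut) : cutoffSaddle χ v θ w = w := by
  have : χ w = 0 := χ.zero_of_le_dist (le_of_lt (by simpa using hw))
  simp [cutoffSaddle, this]

theorem cutoffSaddle_of_mem (χ : ContDiffBump (0 : SplitSpace s u)) (v : SplitSpace s u) (θ : ℝ)
    {w : SplitSpace s u} (hw : ‖w‖ ≤ χ.rIn) : cutoffSaddle χ v θ w = affineSaddle θ v w := by
  have : χ w = 1 := χ.one_of_mem_closedBall (by simpa using hw)
  simp [cutoffSaddle, affineSaddle, this]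

/-- For bounded `v` the maps `cutoffSaddle χ v θ` depend in a Lipschitz way on `θ`, and they are
`C^1`-close to the identity for small `θ`. -/
theorem exists_bound_cutoffSaddle (χ : ContDiffBump (0 : SplitSpace s u)) :
    ∃ C : ℝ, 0 < C ∧ ∀ v : SplitSpace s u, ‖v‖ ≤ 2 →
      (∀ θ : ℝ, |θ| ≤ 1 → ∀ w,
        ‖fderiv ℝ (cutoffSaddle χ v θ) w - ContinuousLinearMap.id ℝ _‖ ≤ C * |θ|) ∧
      ∀ θ θ' : ℝ, |θ| ≤ 1 → |θ'| ≤ 1 → ∀ w,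
        ‖cutoffSaddle χ v θ w - cutoffSaddle χ v θ' w‖ ≤ C * |θ - θ'| := by
  let a : SplitSpace s u → SplitSpace s u := fun w => χ w • saddle s u w
  have hχ : ContDiff ℝ 1 χ := χ.contDiff
  have ha : ContDiff ℝ 1 a := hχ.smul (saddle s u).contDiff
  have hcχ : HasCompactSupport χ := χ.hasCompactSupport
  have hca : HasCompactSupport a := hcχ.smul_right
  obtain ⟨A, hA⟩ := hca.exists_bound_of_continuous ha.continuous
  obtain ⟨A', hA'⟩ := (hca.fderiv (𝕜 := ℝ)).exists_bound_of_continuous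
    (ha.continuous_fderiv one_ne_zero)
  obtain ⟨X', hX'⟩ := (hcχ.fderiv (𝕜 := ℝ)).exists_bound_of_continuous
    (hχ.continuous_fderiv one_ne_zero)
  have hA0 : 0 ≤ A := (norm_nonneg _).trans (hA 0)
  have hA'0 : 0 ≤ A' := (norm_nonneg _).trans (hA' 0)
  have hX'0 : 0 ≤ X' := (norm_nonneg _).trans (hX' 0)
  have heq : ∀ v θ w, cutoffSaddle χ v θ w = w + (θ • a w + (θ * (θ / 4)) • (χ w • v)) := by
    intro v θ w
    simp only [cutoffSaddle, a, smul_add, smul_smul]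
    congr 3
    ring
  refine ⟨A + A' + X' + 1, by positivity, fun v hv => ⟨fun θ hθ w => ?_, fun θ θ' hθ hθ' w => ?_⟩⟩
  · have hd : HasFDerivAt (cutoffSaddle χ v θ) (ContinuousLinearMap.id ℝ _ +
        (θ • fderiv ℝ a w + (θ * (θ / 4)) • (fderiv ℝ χ w).smulRight v)) w := by
      rw [show cutoffSaddle χ v θ = fun w => w + (θ • a w + (θ * (θ / 4)) • (χ w • v)) from
        funext (heq v θ)]
      have h2 := (ha.differentiable one_ne_zero w).hasFDerivAt.fun_const_smul θ
      have h3 := ((hχ.differentiable one_ne_zero w).hasFDerivAt.smul_const v).fun_const_smul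
        (θ * (θ / 4))
      exact (hasFDerivAt_id w).add (h2.add h3)
    rw [hd.fderiv, add_sub_cancel_left]
    calc ‖θ • fderiv ℝ a w + (θ * (θ / 4)) • (fderiv ℝ χ w).smulRight v‖
        ≤ |θ| * A' + (|θ| * (1 / 4)) * (X' * 2) := by
          refine (norm_add_le _ _).trans (add_le_add ?_ ?_)
          · rw [norm_smul, Real.norm_eq_abs]
            gcongr
            exact hA' w
          · rw [norm_smul, ContinuousLinearMap.norm_smulRight_apply, Real.norm_eq_abs, abs_mul,
              abs_div, abs_of_pos (by norm_num : (0 : ℝ) < 4)]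
            gcongr
            exact hX' w
      _ ≤ (A + A' + X' + 1) * |θ| := by
          nlinarith [abs_nonneg θ, mul_nonneg hX'0 (abs_nonneg θ), mul_nonneg hA0 (abs_nonneg θ)]
  · have h1 : cutoffSaddle χ v θ w - cutoffSaddle χ v θ' w
        = (θ - θ') • a w + ((θ - θ') * ((θ + θ') / 4)) • (χ w • v) := by
      rw [heq, heq]; module
    rw [h1]
    have hχ1 : ‖χ w‖ ≤ 1 := by
      rw [Real.norm_eq_abs, abs_of_nonneg χ.nonneg]; exact χ.le_one
    have hsum : |θ + θ'| ≤ 2 := (abs_add_le _ _).trans (by linarith)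
    calc ‖(θ - θ') • a w + ((θ - θ') * ((θ + θ') / 4)) • (χ w • v)‖
        ≤ |θ - θ'| * A + (|θ - θ'| * (2 / 4)) * (1 * 2) := by
          refine (norm_add_le _ _).trans (add_le_add ?_ ?_)
          · rw [norm_smul, Real.norm_eq_abs]
            gcongr
            exact hA w
          · rw [norm_smul, norm_smul, Real.norm_eq_abs, abs_mul,
              abs_div, abs_of_pos (by norm_num : (0 : ℝ) < 4)]
            gcongr
      _ ≤ (A + A' + X' + 1) * |θ - θ'| := by
          nlinarith [abs_nonneg (θ - θ'), mul_nonneg hX'0 (abs_nonneg (θ - θ')),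
            mul_nonneg hA'0 (abs_nonneg (θ - θ'))]

/-- For all large `n` the ball of radius `2` has a `1 / 32`-net of `n` points. -/
theorem exists_net (s u : ℕ) : ∃ k : ℕ, ∀ n : ℕ, k ≤ n → ∃ v : Fin n → SplitSpace s u,
    (∀ i, ‖v i‖ ≤ 2) ∧ ∀ w, ‖w‖ ≤ 2 → ∃ i, ‖w - v i‖ < 1 / 32 := by
  obtain ⟨t, ht, htf, hcov⟩ := Metric.finite_approx_of_totallyBounded
    (isCompact_closedBall (0 : SplitSpace s u) 2).totallyBounded (1 / 32) (by norm_num)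
  lift t to Finset (SplitSpace s u) using htf
  refine ⟨t.card, fun n hn => ⟨fun i => if h : (i : ℕ) < t.card then t.equivFin.symm ⟨i, h⟩ else 0,
    fun i => ?_, fun w hw => ?_⟩⟩
  · dsimp only
    split_ifs with h
    · simpa using ht (t.equivFin.symm ⟨i, h⟩).2
    · simp
  · obtain ⟨z, hz, hwz⟩ := mem_iUnion₂.1 (hcov (by simpa using hw : w ∈ _))
    refine ⟨⟨t.equivFin ⟨z, hz⟩, (t.equivFin ⟨z, hz⟩).2.trans_le hn⟩, ?_⟩
    simpa [dist_eq_norm] using hwz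

end Family

/-! ### Iterates of one-step skew products -/

section SkewProducts

variable {ι M : Type*} (φ : ι → M ≃ M)

theorem fiberIterate_zero (ξ : ℤ → ι) (y : M) : fiberIterate φ 0 ξ y = y := by
  simp [fiberIterate]

theorem oneStepSkewProduct_zpow_apply (n : ℤ) (ξ : ℤ → ι) (y : M) :
    (oneStepSkewProduct φ ^ n) (ξ, y) = (fun j => ξ (j + n), fiberIterate φ n ξ y) := by
  refine Prod.ext ?_ rfl
  induction n using Int.induction_on with
  | zero => simp
  | succ n ih =>
    rw [add_comm, zpow_one_add, Equiv.Perm.mul_apply]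
    funext j
    change ((oneStepSkewProduct φ ^ (n : ℤ)) (ξ, y)).1 (j + 1) = _
    rw [ih]
    ring_nf
  | pred n ih =>
    have h : (oneStepSkewProduct φ ^ (-(n : ℤ) - 1))
        = (oneStepSkewProduct φ)⁻¹ * oneStepSkewProduct φ ^ (-(n : ℤ)) := by group
    rw [h, Equiv.Perm.mul_apply]
    funext j
    change ((oneStepSkewProduct φ ^ (-(n : ℤ))) (ξ, y)).1 (j - 1) = _
    rw [ih]
    ring_nf

theorem fiberIterate_add_one (n : ℤ) (ξ : ℤ → ι) (y : M) :
    fiberIterate φ (n + 1) ξ y = φ (ξ n) (fiberIterate φ n ξ y) := by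
  have h := congrArg Prod.snd (congrFun (congrArg DFunLike.coe
    (zpow_one_add (oneStepSkewProduct φ) n)) (ξ, y))
  rw [Equiv.Perm.mul_apply, oneStepSkewProduct_zpow_apply φ n, add_comm 1 n] at h
  rw [fiberIterate, h]
  simp [oneStepSkewProduct]

/-- A sequence of points that is a full orbit over `ξ` is given by the iterates of the skew-product,
in negative times as well. -/
theorem fiberIterate_eq_of_orbit {ξ : ℤ → ι} {p : ℤ → M} (hp : ∀ n, p (n + 1) = φ (ξ n) (p n))
    (n : ℤ) : fiberIterate φ n ξ (p 0) = p n := by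
  induction n using Int.induction_on with
  | zero => rw [fiberIterate_zero]
  | succ n ih => rw [fiberIterate_add_one, ih, hp]
  | pred n ih =>
    apply (φ (ξ (-(n : ℤ) - 1))).injective
    rw [← fiberIterate_add_one, ← hp, sub_add_cancel, ih]

variable [TopologicalSpace M] {φ}

theorem mem_maximalInvariantSet {D : Set M} {p : (ℤ → ι) × M} :
    p ∈ maximalInvariantSet φ D ↔ ∀ n : ℤ, fiberIterate φ n p.1 p.2 ∈ closure D := by
  have h : ∀ n : ℤ, p ∈ (oneStepSkewProduct φ ^ n) '' (univ ×ˢ closure D) ↔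
      fiberIterate φ (-n) p.1 p.2 ∈ closure D := by
    intro n
    rw [Equiv.image_eq_preimage_symm, mem_preimage]
    change ((oneStepSkewProduct φ ^ n)⁻¹ p) ∈ _ ↔ _
    rw [← zpow_neg]
    simp [fiberIterate]
  simp only [maximalInvariantSet, mem_iInter, h]
  exact ⟨fun H n => by simpa using H (-n), fun H n => H (-n)⟩

theorem image_maximalInvariantSet (D : Set M) :
    oneStepSkewProduct φ '' maximalInvariantSet φ D = maximalInvariantSet φ D := by
  ext p
  rw [Equiv.image_eq_preimage_symm, mem_preimage, mem_maximalInvariantSet, mem_maximalInvariantSet]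
  have h : ∀ n : ℤ, fiberIterate φ n ((oneStepSkewProduct φ).symm p).1
      ((oneStepSkewProduct φ).symm p).2 = fiberIterate φ (n - 1) p.1 p.2 := by
    intro n
    have : oneStepSkewProduct φ ^ (n - 1)
        = oneStepSkewProduct φ ^ n * (oneStepSkewProduct φ)⁻¹ := zpow_sub_one _ _
    simp only [fiberIterate, this]
    rfl
  simp only [h]
  exact ⟨fun H n => by simpa using H (n + 1), fun H n => H _⟩

end SkewProducts

/-! ### A dense orbit of the full shift -/

section Shift

/-- The full shift on a finite alphabet has a point with a dense forward orbit: place the `k`-th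
element of a dense sequence of bi-infinite words, truncated to a window of length growing with `n`,
in the block of positions `[2 ^ (n + 1), 2 ^ (n + 2))`, for infinitely many `n`. -/
theorem exists_dense_forward_shift_orbit (ι : Type*) [TopologicalSpace ι] [DiscreteTopology ι]
    [Finite ι] [Nonempty ι] :
    ∃ ξ : ℤ → ι, ∀ ζ, ζ ∈ closure (range fun n : ℕ => fun j : ℤ => ξ (j + n)) := by
  have : SecondCountableTopology ι := inferInstance
  let f := TopologicalSpace.denseSeq (ℤ → ι)
  let lev : ℤ → ℕ := fun j => Nat.log 2 j.toNat - 1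
  refine ⟨fun j => f (Nat.unpair (lev j)).1 (j - 3 * 2 ^ lev j), fun ζ => ?_⟩
  rw [mem_closure_iff]
  intro U hU hζ
  obtain ⟨_, hfU, m, rfl⟩ :=
    (TopologicalSpace.denseRange_denseSeq (ℤ → ι)).inter_open_nonempty U hU ⟨ζ, hζ⟩
  obtain ⟨I, w, hw, hIU⟩ := isOpen_pi_iff.1 hU _ hfU
  let n := Nat.pair m (I.sup Int.natAbs)
  have hn : I.sup Int.natAbs < 2 ^ n := (Nat.right_le_pair _ _).trans_lt Nat.lt_two_pow_self
  refine ⟨_, hIU ?_, 3 * 2 ^ n, rfl⟩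
  intro j hj
  have hjn : j.natAbs < 2 ^ n := (Finset.le_sup (f := Int.natAbs) hj).trans_lt hn
  have hlev : lev (j + (3 * 2 ^ n : ℕ)) = n := by
    have h2 : ((2 ^ n : ℕ) : ℤ) = 2 ^ n := by push_cast; rfl
    have : Nat.log 2 (j + (3 * 2 ^ n : ℕ)).toNat = n + 1 := by
      rw [Nat.log_eq_iff (Or.inl (by omega))]
      rw [pow_succ, pow_succ, pow_succ]
      omega
    simp only [lev, this]
    rfl
  have hfm : (Nat.unpair n).1 = m := by simp [n]
  change f (Nat.unpair (lev (j + (3 * 2 ^ n : ℕ)))).1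
    (j + (3 * 2 ^ n : ℕ) - 3 * 2 ^ lev (j + (3 * 2 ^ n : ℕ))) ∈ w j
  rw [hlev, hfm]
  have : j + ((3 * 2 ^ n : ℕ) : ℤ) - 3 * 2 ^ n = j := by push_cast; ring
  rw [this]
  exact (hw j hj).2

end Shift

/-! ### Orbits of the linear saddle -/

section Saddle

variable {s u : ℕ}

theorem affineSaddle_zero_fst (θ : ℝ) (w : SplitSpace s u) :
    (affineSaddle θ 0 w).1 = (1 - θ) • w.1 := by
  simp only [affineSaddle, saddle, smul_zero, add_zero, Prod.fst_add, Prod.smul_fst]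
  simp only [ContinuousLinearMap.prod_apply, neg_apply,
    ContinuousLinearMap.coe_fst']
  module

theorem affineSaddle_zero_snd (θ : ℝ) (w : SplitSpace s u) :
    (affineSaddle θ 0 w).2 = (1 + θ) • w.2 := by
  simp [affineSaddle, saddle, add_smul]

theorem affineSaddle_eq (θ : ℝ) (v w : SplitSpace s u) :
    affineSaddle θ v w = affineSaddle θ 0 w + (θ ^ 2 / 4) • v := by
  simp only [affineSaddle]
  module

theorem affineSaddle_sub (θ : ℝ) (v w z : SplitSpace s u) :
    affineSaddle θ v w - affineSaddle θ v z = affineSaddle θ 0 (w - z) := by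
  simp only [affineSaddle, map_sub]
  module

theorem hasFDerivAt_affineSaddle (θ : ℝ) (v w : SplitSpace s u) :
    HasFDerivAt (affineSaddle θ v) (ContinuousLinearMap.id ℝ _ + θ • saddle s u) w :=
  (hasFDerivAt_id w).add (((saddle s u).hasFDerivAt.add_const _).fun_const_smul θ)

theorem fderiv_affineSaddle (θ : ℝ) (v w z : SplitSpace s u) :
    fderiv ℝ (affineSaddle θ v) w z = affineSaddle θ 0 z := by
  rw [(hasFDerivAt_affineSaddle θ v w).fderiv]
  simp [affineSaddle]

theorem forward_fst {θ : ℝ} {a : ℕ → SplitSpace s u}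
    (ha : ∀ n, a (n + 1) = affineSaddle θ 0 (a n)) (n : ℕ) :
    (a n).1 = (1 - θ) ^ n • (a 0).1 := by
  induction n with
  | zero => simp
  | succ n ih => rw [ha, affineSaddle_zero_fst, ih, smul_smul, pow_succ']

theorem forward_snd {θ : ℝ} {a : ℕ → SplitSpace s u}
    (ha : ∀ n, a (n + 1) = affineSaddle θ 0 (a n)) (n : ℕ) :
    (a n).2 = (1 + θ) ^ n • (a 0).2 := by
  induction n with
  | zero => simp
  | succ n ih => rw [ha, affineSaddle_zero_snd, ih, smul_smul, pow_succ']

theorem backward_fst {θ : ℝ} {b : ℕ → SplitSpace s u}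
    (hb : ∀ n, b n = affineSaddle θ 0 (b (n + 1))) (n : ℕ) :
    (b 0).1 = (1 - θ) ^ n • (b n).1 := by
  induction n with
  | zero => simp
  | succ n ih => rw [ih, hb n, affineSaddle_zero_fst, smul_smul, pow_succ]

theorem backward_snd {θ : ℝ} {b : ℕ → SplitSpace s u}
    (hb : ∀ n, b n = affineSaddle θ 0 (b (n + 1))) (n : ℕ) :
    (b 0).2 = (1 + θ) ^ n • (b n).2 := by
  induction n with
  | zero => simp
  | succ n ih => rw [ih, hb n, affineSaddle_zero_snd, smul_smul, pow_succ]

/-- A bounded forward orbit of the linear saddle lies in the contracted subspace. -/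
theorem forward_snd_eq_zero {θ : ℝ} (hθ : 0 < θ) {a : ℕ → SplitSpace s u}
    (ha : ∀ n, a (n + 1) = affineSaddle θ 0 (a n)) {C : ℝ} (hC : ∀ n, ‖a n‖ ≤ C) :
    (a 0).2 = 0 := by
  by_contra h
  have hpos : 0 < ‖(a 0).2‖ := norm_pos_iff.2 h
  obtain ⟨n, hn⟩ := pow_unbounded_of_one_lt (C / ‖(a 0).2‖) (by linarith : 1 < 1 + θ)
  have h1 := (norm_snd_le (a n)).trans (hC n)
  rw [forward_snd ha, norm_smul, norm_pow, Real.norm_of_nonneg (by linarith)] at h1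
  rw [div_lt_iff₀ hpos] at hn
  linarith

/-- A bounded backward orbit of the linear saddle lies in the expanded subspace. -/
theorem backward_fst_eq_zero {θ : ℝ} (hθ : 0 < θ) (hθ1 : θ < 1) {b : ℕ → SplitSpace s u}
    (hb : ∀ n, b n = affineSaddle θ 0 (b (n + 1))) {C : ℝ} (hC : ∀ n, ‖b n‖ ≤ C) :
    (b 0).1 = 0 := by
  have hlim : Tendsto (fun n : ℕ => (1 - θ) ^ n * C) atTop (𝓝 (0 * C)) :=
    (tendsto_pow_atTop_nhds_zero_of_lt_one (by linarith) (by linarith)).mul_const C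
  rw [zero_mul] at hlim
  refine norm_le_zero_iff.1 (ge_of_tendsto hlim (Eventually.of_forall fun n => ?_))
  rw [backward_fst hb n, norm_smul, norm_pow, Real.norm_of_nonneg (by linarith)]
  have := (norm_fst_le (b n)).trans (hC n)
  have h0 : 0 ≤ (1 - θ) ^ n := pow_nonneg (by linarith) n
  gcongr

/-- Exponential decay in the contracted subspace. The rate `1 - θ` is weakened to `(1 + θ)⁻¹`, the
rate of the backward orbits in the expanded subspace. -/
theorem norm_forward_le {θ : ℝ} (hθ : 0 < θ) (hθ1 : θ < 1) {a : ℕ → SplitSpace s u}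
    (ha : ∀ n, a (n + 1) = affineSaddle θ 0 (a n)) (h0 : (a 0).2 = 0) (n : ℕ) :
    ‖a n‖ ≤ ((1 + θ)⁻¹) ^ n * ‖a 0‖ := by
  have h1 : (a n).2 = 0 := by rw [forward_snd ha, h0, smul_zero]
  have h2 : 1 - θ ≤ (1 + θ)⁻¹ := by
    rw [le_inv_comm₀ (by linarith) (by linarith), ← one_div, le_div_iff₀ (by linarith)]
    nlinarith
  have h3 : ‖(a n).1‖ ≤ ((1 + θ)⁻¹) ^ n * ‖a 0‖ := by
    rw [forward_fst ha, norm_smul, norm_pow, Real.norm_of_nonneg (by linarith)]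
    have : 0 ≤ 1 - θ := by linarith
    gcongr
    exact norm_fst_le _
  rw [Prod.norm_def, h1, norm_zero]
  exact max_le h3 (by positivity)

theorem norm_backward_le {θ : ℝ} (hθ : 0 < θ) (hθ1 : θ < 1) {b : ℕ → SplitSpace s u}
    (hb : ∀ n, b n = affineSaddle θ 0 (b (n + 1))) (h0 : (b 0).1 = 0) (n : ℕ) :
    ‖b n‖ ≤ ((1 + θ)⁻¹) ^ n * ‖b 0‖ := by
  have h1 : (b n).1 = 0 := by
    have := backward_fst hb n
    rw [h0] at this
    exact (smul_eq_zero.1 this.symm).resolve_left (pow_ne_zero n (by linarith))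
  have h3 : ‖(b n).2‖ ≤ ((1 + θ)⁻¹) ^ n * ‖b 0‖ := by
    have h4 := norm_snd_le (b 0)
    rw [backward_snd hb n, norm_smul, norm_pow, Real.norm_of_nonneg (by linarith)] at h4
    rw [inv_pow, ← div_eq_inv_mul, le_div_iff₀ (by positivity), mul_comm]
    exact h4
  rw [Prod.norm_def, h1, norm_zero]
  exact max_le (by positivity) h3

end Saddle

/-! ### Discounted sums -/

section BoundedOrbits

variable {ι E : Type*} [NormedAddCommGroup E] [NormedSpace ℝ E]

/-- The sum of the geometrically discounted values of `a` along the positions `idx` of a word. -/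
noncomputable def discountedSum (κ : ℝ) (a : ι → E) (idx : ℕ → ℤ) (ξ : ℤ → ι) : E :=
  ∑' n : ℕ, κ ^ n • a (ξ (idx n))

variable {κ : ℝ} {a : ι → E} {B : ℝ}

theorem norm_discount_le (h0 : 0 ≤ κ) (hB : ∀ i, ‖a i‖ ≤ B) (idx : ℕ → ℤ) (ξ : ℤ → ι) (n : ℕ) :
    ‖κ ^ n • a (ξ (idx n))‖ ≤ κ ^ n * B := by
  rw [norm_smul, norm_pow, Real.norm_of_nonneg h0]
  gcongr
  exact hB _

theorem norm_discountedSum_le (h0 : 0 ≤ κ) (h1 : κ < 1) (hB : ∀ i, ‖a i‖ ≤ B)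
    (idx : ℕ → ℤ) (ξ : ℤ → ι) :
    ‖discountedSum κ a idx ξ‖ ≤ (1 - κ)⁻¹ * B :=
  tsum_of_norm_bounded ((hasSum_geometric_of_lt_one h0 h1).mul_right B)
    (norm_discount_le h0 hB idx ξ)

theorem discountedSum_eq [CompleteSpace E] (h0 : 0 ≤ κ) (h1 : κ < 1) (hB : ∀ i, ‖a i‖ ≤ B)
    (idx : ℕ → ℤ) (ξ : ℤ → ι) :
    discountedSum κ a idx ξ
      = a (ξ (idx 0)) + κ • discountedSum κ a (fun n => idx (n + 1)) ξ := by
  have hs : Summable fun n : ℕ => κ ^ n • a (ξ (idx n)) :=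
    Summable.of_norm_bounded ((summable_geometric_of_lt_one h0 h1).mul_right B)
      (norm_discount_le h0 hB idx ξ)
  rw [discountedSum, hs.tsum_eq_zero_add, discountedSum, ← tsum_const_smul'']
  simp only [pow_zero, one_smul, smul_smul, pow_succ']

theorem continuous_discountedSum [CompleteSpace E] [TopologicalSpace ι] [DiscreteTopology ι]
    (h0 : 0 ≤ κ) (h1 : κ < 1) (hB : ∀ i, ‖a i‖ ≤ B) (idx : ℕ → ℤ) :
    Continuous (discountedSum κ a idx) :=
  continuous_tsum (fun n => (continuous_of_discreteTopology.comp
    (continuous_apply (idx n))).const_smul (κ ^ n))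
    ((summable_geometric_of_lt_one h0 h1).mul_right B)
    (fun n ξ => norm_discount_le h0 hB idx ξ n)

end BoundedOrbits

/-! ### The maximal invariant set of local saddles -/

section LocalSaddles

variable {c : ℕ} {M : Type*} [EMetricSpace M] [ChartedSpace (EuclideanSpace ℝ (Fin c)) M]
  [RiemannianBundle (fun x : M => TangentSpace (𝓡 c) x)] {ι : Type*} {s u : ℕ}

/-- The maps `φ i`, read in the chart `e`, are on the ball of radius `R` affine saddle maps with
rates `1 - θ` and `1 + θ`, where `θ` is small compared with the size of the chart. Nothing is
required of the maps outside the preimage of this ball. -/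
structure IsLocalSaddle (x : M) (e : OpenPartialHomeomorph M (SplitSpace s u)) (q R ρ θ : ℝ)
    (v : ι → SplitSpace s u) (φ : ι → M ≃ M) : Prop where
  controlled : IsControlled (c := c) x e q R ρ
  mem_source : x ∈ e.source
  map_base : e x = 0
  θ_pos : 0 < θ
  θ_lt_one : θ < 1
  θ_le_radius : 2 * θ ≤ R
  θ_le_ρ : 8 * θ ≤ ρ
  norm_le_two : ∀ i, ‖v i‖ ≤ 2
  map_mem : ∀ i, ∀ y ∈ e.source, ‖e y‖ ≤ R → φ i y ∈ e.source
  map_eq : ∀ i, ∀ y ∈ e.source, ‖e y‖ ≤ R → e (φ i y) = affineSaddle θ (v i) (e y)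

/-- The preimage under the chart of the ball of radius `θ`. -/
def chartBall {M F : Type*} [TopologicalSpace M] [NormedAddCommGroup F]
    (e : OpenPartialHomeomorph M F) (θ : ℝ) : Set M :=
  e.source ∩ e ⁻¹' Metric.ball 0 θ

/-- The closure in `M` of a set that lies in the preimage of a closed ball contained in the target of
the chart stays in this preimage, as the preimage is compact. -/
theorem closure_subset_of_norm_le {F : Type*} [NormedAddCommGroup F] [NormedSpace ℝ F]
    [ProperSpace F] {e : OpenPartialHomeomorph M F} {θ : ℝ}
    (h : Metric.closedBall 0 θ ⊆ e.target) {A : Set M} (hA : ∀ y ∈ A, y ∈ e.source ∧ ‖e y‖ ≤ θ)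
    {y : M} (hy : y ∈ closure A) : y ∈ e.source ∧ ‖e y‖ ≤ θ := by
  have hsub : A ⊆ e.symm '' Metric.closedBall 0 θ := fun z hz =>
    ⟨e z, by simpa using (hA z hz).2, e.left_inv (hA z hz).1⟩
  obtain ⟨w, hw, rfl⟩ :=
    closure_minimal hsub (isClosed_symm_image (isCompact_closedBall 0 θ) h) hy
  exact ⟨e.map_target (h hw), by simpa [e.right_inv (h hw)] using hw⟩

namespace IsLocalSaddle

variable {x : M} {e : OpenPartialHomeomorph M (SplitSpace s u)} {q R ρ θ : ℝ}
  {v : ι → SplitSpace s u} {φ : ι → M ≃ M} (H : IsLocalSaddle (c := c) x e q R ρ θ v φ)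
include H

theorem closedBall_subset {a : ℝ} (ha : a ≤ R) : Metric.closedBall 0 a ⊆ e.target :=
  (Metric.closedBall_subset_closedBall (by linarith [H.controlled.radius_pos])).trans
    H.controlled.closedBall_subset

theorem norm_le_of_mem {ξ : ℤ → ι} {y : M} (hy : (ξ, y) ∈ maximalInvariantSet φ (chartBall e θ))
    (n : ℤ) : fiberIterate φ n ξ y ∈ e.source ∧ ‖e (fiberIterate φ n ξ y)‖ ≤ θ := by
  have := H.θ_le_radius
  have := H.θ_pos
  refine closure_subset_of_norm_le (H.closedBall_subset (by linarith)) (fun z hz => ?_)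
    (mem_maximalInvariantSet.1 hy n)
  exact ⟨hz.1, le_of_lt (by simpa using hz.2)⟩

theorem map_fiberIterate {n : ℤ} {ξ : ℤ → ι} {y : M} (h : fiberIterate φ n ξ y ∈ e.source)
    (hn : ‖e (fiberIterate φ n ξ y)‖ ≤ R) :
    e (fiberIterate φ (n + 1) ξ y) = affineSaddle θ (v (ξ n)) (e (fiberIterate φ n ξ y)) := by
  rw [fiberIterate_add_one, H.map_eq _ _ h hn]

/-- The position, in the chart, of a point over `ξ` whose full orbit stays near `x`. Its contracted
component is a discounted sum over the past of `ξ`, its expanded component a discounted sum over the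
future. The bound holds since the translation parts have norm at most `θ ^ 2 / 2` and the geometric
series with ratios `1 - θ` and `(1 + θ)⁻¹` have sums of order `1 / θ`. -/
theorem exists_bounded_orbit [TopologicalSpace ι] [DiscreteTopology ι] :
    ∃ p : (ℤ → ι) → SplitSpace s u, Continuous p ∧ (∀ ξ, ‖p ξ‖ ≤ θ / 2) ∧
      ∀ ξ, p (fun j => ξ (j + 1)) = affineSaddle θ (v (ξ 0)) (p ξ) := by
  have h0 := H.θ_pos
  have h1 := H.θ_lt_one
  have hinv : (1 + θ)⁻¹ < 1 := inv_lt_one_of_one_lt₀ (by linarith)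
  have hinv0 : 0 ≤ (1 + θ)⁻¹ := inv_nonneg.2 (by linarith)
  let a : ι → EuclideanSpace ℝ (Fin s) := fun i => (θ ^ 2 / 4) • (v i).1
  let b : ι → EuclideanSpace ℝ (Fin u) := fun i => (θ ^ 2 / 4) • (v i).2
  have ha : ∀ i, ‖a i‖ ≤ θ ^ 2 / 2 := fun i => by
    have h2 := (norm_fst_le (v i)).trans (H.norm_le_two i)
    rw [norm_smul, Real.norm_of_nonneg (by positivity)]
    nlinarith [sq_nonneg θ]
  have hb : ∀ i, ‖b i‖ ≤ θ ^ 2 / 2 := fun i => by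
    have h2 := (norm_snd_le (v i)).trans (H.norm_le_two i)
    rw [norm_smul, Real.norm_of_nonneg (by positivity)]
    nlinarith [sq_nonneg θ]
  let p : (ℤ → ι) → SplitSpace s u := fun ξ =>
    (discountedSum (1 - θ) a (fun n => -(n : ℤ) - 1) ξ,
      -((1 + θ)⁻¹ • discountedSum (1 + θ)⁻¹ b (fun n => (n : ℤ)) ξ))
  have h1θ0 : 0 ≤ 1 - θ := by linarith
  have h1θ1 : 1 - θ < 1 := by linarith
  refine ⟨p, ?_, fun ξ => ?_, fun ξ => ?_⟩
  · have hc := continuous_discountedSum hinv0 hinv hb fun n => (n : ℤ)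
    exact (continuous_discountedSum h1θ0 h1θ1 ha _).prodMk (by fun_prop)
  · refine max_le ?_ ?_
    · refine (norm_discountedSum_le h1θ0 h1θ1 ha _ ξ).trans (le_of_eq ?_)
      rw [sub_sub_cancel]
      field_simp
    · rw [norm_neg, norm_smul, Real.norm_of_nonneg hinv0]
      refine (mul_le_mul_of_nonneg_left (norm_discountedSum_le hinv0 hinv hb _ ξ) hinv0).trans
        (le_of_eq ?_)
      have : 1 - (1 + θ)⁻¹ = θ * (1 + θ)⁻¹ := by field_simp; ring
      rw [this]
      field_simp
  · rw [affineSaddle_eq]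
    refine Prod.ext ?_ ?_
    · rw [Prod.fst_add, affineSaddle_zero_fst]
      change discountedSum (1 - θ) a (fun n => -(n : ℤ) - 1) (fun j => ξ (j + 1))
        = (1 - θ) • discountedSum (1 - θ) a (fun n => -(n : ℤ) - 1) ξ + a (ξ 0)
      rw [discountedSum_eq h1θ0 h1θ1 ha, add_comm]
      congr 2
      · simp only [discountedSum]
        refine tsum_congr fun n => ?_
        congr 3
        push_cast
        ring
    · rw [Prod.snd_add, affineSaddle_zero_snd]
      change -((1 + θ)⁻¹ • discountedSum (1 + θ)⁻¹ b (fun n => (n : ℤ)) (fun j => ξ (j + 1)))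
        = (1 + θ) • -((1 + θ)⁻¹ • discountedSum (1 + θ)⁻¹ b (fun n => (n : ℤ)) ξ) + b (ξ 0)
      rw [discountedSum_eq hinv0 hinv hb (fun n => (n : ℤ)) ξ]
      have : discountedSum (1 + θ)⁻¹ b (fun n => (n : ℤ)) (fun j => ξ (j + 1))
          = discountedSum (1 + θ)⁻¹ b (fun n => ((n + 1 : ℕ) : ℤ)) ξ := by
        simp [discountedSum]
      rw [this, smul_neg, smul_smul, mul_inv_cancel₀ (by linarith), one_smul]
      simp

/-- The maximal invariant set is the graph of a continuous function on the full shift that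
conjugates the shift with the skew-product. -/
theorem exists_eq_range [TopologicalSpace ι] [DiscreteTopology ι] :
    ∃ g : (ℤ → ι) → (ℤ → ι) × M, Continuous g ∧
      range g = maximalInvariantSet φ (chartBall e θ) ∧
      ∀ (n : ℕ) (ξ : ℤ → ι), (oneStepSkewProduct φ ^ n) (g ξ) = g fun j => ξ (j + n) := by
  obtain ⟨p, hpc, hpn, hps⟩ := H.exists_bounded_orbit
  have h0 := H.θ_pos
  have h1 := H.θ_le_radius
  have hpR : ∀ ξ, ‖p ξ‖ ≤ R := fun ξ => (hpn ξ).trans (by linarith)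
  have hpt : ∀ ξ, p ξ ∈ e.target := fun ξ => H.closedBall_subset le_rfl (by simpa using hpR ξ)
  have hshift : ∀ (ξ : ℤ → ι) (n : ℤ), p (fun j => ξ (j + (n + 1)))
      = affineSaddle θ (v (ξ n)) (p fun j => ξ (j + n)) := by
    intro ξ n
    have := hps fun j => ξ (j + n)
    simp only [zero_add] at this
    rw [← this]
    congr 1
    funext j
    congr 1
    ring
  have horb : ∀ (ξ : ℤ → ι) (n : ℤ),
      fiberIterate φ n ξ (e.symm (p ξ)) = e.symm (p fun j => ξ (j + n)) := by
    intro ξ n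
    have := fiberIterate_eq_of_orbit φ (ξ := ξ) (p := fun n => e.symm (p fun j => ξ (j + n))) ?_ n
    · simpa using this
    · intro n
      have hs := e.map_target (hpt fun j => ξ (j + n))
      have he := e.right_inv (hpt fun j => ξ (j + n))
      have hn : ‖e (e.symm (p fun j => ξ (j + n)))‖ ≤ R := by rw [he]; exact hpR _
      rw [← e.left_inv (H.map_mem (ξ n) _ hs hn), H.map_eq _ _ hs hn, he, hshift]
  refine ⟨fun ξ => (ξ, e.symm (p ξ)), ?_, ?_, ?_⟩
  · exact continuous_id.prodMk (e.continuousOn_symm.comp_continuous hpc hpt)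
  · ext ⟨ξ, y⟩
    constructor
    · rintro ⟨ζ, hζ⟩
      obtain ⟨rfl, rfl⟩ := Prod.ext_iff.1 hζ
      rw [mem_maximalInvariantSet]
      intro n
      refine subset_closure ?_
      simp only [horb]
      refine ⟨e.map_target (hpt _), ?_⟩
      rw [mem_preimage, e.right_inv (hpt _), mem_ball_zero_iff]
      exact (hpn _).trans_lt (by linarith)
    · intro hy
      have hyn := H.norm_le_of_mem hy
      -- the difference of two bounded orbits over `ξ` is a bounded orbit of the linear saddle
      let d : ℤ → SplitSpace s u := fun n => e (fiberIterate φ n ξ y) - p fun j => ξ (j + n)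
      have hd : ∀ n, d (n + 1) = affineSaddle θ 0 (d n) := by
        intro n
        simp only [d]
        rw [H.map_fiberIterate (hyn n).1 ((hyn n).2.trans (by linarith)), hshift, affineSaddle_sub]
      have hdb : ∀ n, ‖d n‖ ≤ 2 * θ := fun n =>
        (norm_sub_le _ _).trans (by linarith [(hyn n).2, hpn fun j => ξ (j + n)])
      have hfst : (d 0).1 = 0 := by
        refine backward_fst_eq_zero (b := fun n : ℕ => d (-n)) h0 H.θ_lt_one ?_
          (fun n => hdb _)
        intro n
        rw [← hd]
        congr 1
        push_cast
        ring
      have hsnd : (d 0).2 = 0 :=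
        forward_snd_eq_zero (a := fun n : ℕ => d n) h0 (fun n => hd n) fun n => hdb _
      have h00 : d 0 = 0 := Prod.ext hfst hsnd
      simp only [d, fiberIterate_zero, add_zero, sub_eq_zero] at h00
      refine ⟨ξ, Prod.ext rfl ?_⟩
      simp only
      have hy0 := (hyn 0).1
      rw [fiberIterate_zero] at hy0
      rw [← h00, e.left_inv hy0]
  · intro n ξ
    rw [← zpow_natCast, oneStepSkewProduct_zpow_apply, horb]

theorem isCompact_maximalInvariantSet [TopologicalSpace ι] [DiscreteTopology ι] [Finite ι] :
    IsCompact (maximalInvariantSet φ (chartBall e θ)) := by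
  obtain ⟨g, hg, hr, -⟩ := H.exists_eq_range
  rw [← hr]
  exact isCompact_range hg

theorem isTransitiveSet [TopologicalSpace ι] [DiscreteTopology ι] [Finite ι] [Nonempty ι] :
    IsTransitiveSet (oneStepSkewProduct φ) (maximalInvariantSet φ (chartBall e θ)) := by
  obtain ⟨g, hg, hr, hs⟩ := H.exists_eq_range
  obtain ⟨ξ, hξ⟩ := exists_dense_forward_shift_orbit ι
  rw [← hr]
  refine ⟨g ξ, mem_range_self _, fun n => ?_, ?_⟩
  · rw [hs]; exact mem_range_self _
  · rintro _ ⟨ζ, rfl⟩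
    have := image_closure_subset_closure_image hg ⟨ζ, hξ ζ, rfl⟩
    rw [← range_comp] at this
    simp only [hs]
    exact this

end IsLocalSaddle

end LocalSaddles

/-! ### Exponential decay and local product structure -/

section LocalHyperbolicity

variable {c : ℕ} {M : Type*} [EMetricSpace M] [ChartedSpace (EuclideanSpace ℝ (Fin c)) M]
  [RiemannianBundle (fun x : M => TangentSpace (𝓡 c) x)] {ι : Type*} {s u : ℕ}

namespace IsLocalSaddle

variable {x : M} {e : OpenPartialHomeomorph M (SplitSpace s u)} {q R ρ θ : ℝ}
  {v : ι → SplitSpace s u} {φ : ι → M ≃ M} (H : IsLocalSaddle (c := c) x e q R ρ θ v φ)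
include H

/-- Points close to the points of an orbit that stays near `x` are in the domain of the chart. -/
theorem near_of_edist_le {y z : M} (hy : y ∈ e.source) (hyn : ‖e y‖ ≤ θ)
    (hz : edist y z ≤ ENNReal.ofReal (ρ / 4)) : z ∈ e.source ∧ ‖e z‖ < R := by
  have hρ := H.controlled.ρ_pos
  have h1 := H.θ_le_radius
  have h2 := H.θ_le_ρ
  have h3 := H.θ_pos
  refine H.controlled.near z ?_
  have hxy : edist x y ≤ ENNReal.ofReal (4 * θ) := by
    refine (H.controlled.edist_le x H.mem_source y hy ?_ ?_).trans (ENNReal.ofReal_le_ofReal ?_)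
    · rw [H.map_base, norm_zero]; linarith
    · linarith
    · rw [H.map_base, zero_sub, norm_neg]; linarith
  calc edist x z ≤ edist x y + edist y z := edist_triangle _ _ _
    _ ≤ ENNReal.ofReal (4 * θ) + ENNReal.ofReal (ρ / 4) := add_le_add hxy hz
    _ = ENNReal.ofReal (4 * θ + ρ / 4) := (ENNReal.ofReal_add (by linarith) (by linarith)).symm
    _ < ENNReal.ofReal ρ := (ENNReal.ofReal_lt_ofReal_iff hρ).2 (by linarith)

/-- Exponential decay in the chart gives exponential decay of distances. -/
theorem edist_le_of_decay {y z y' z' : M} (hy : y ∈ e.source) (hz : z ∈ e.source)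
    (hy' : y' ∈ e.source) (hz' : z' ∈ e.source) (hyn : ‖e y‖ ≤ R) (hzn : ‖e z‖ ≤ R)
    (hyn' : ‖e y'‖ ≤ R) (hzn' : ‖e z'‖ ≤ R) {a : ℝ} (ha : 0 ≤ a)
    (h : ‖e y' - e z'‖ ≤ a * ‖e y - e z‖) :
    edist y' z' ≤ ENNReal.ofReal (16 * a) * edist y z := by
  have hR := H.controlled.radius_pos
  calc edist y' z' ≤ ENNReal.ofReal (4 * ‖e y' - e z'‖) :=
        H.controlled.edist_le _ hy' _ hz' (by linarith) (by linarith)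
    _ ≤ ENNReal.ofReal ((4 * a) * ‖e y - e z‖) := ENNReal.ofReal_le_ofReal (by linarith)
    _ = ENNReal.ofReal (4 * a) * ENNReal.ofReal ‖e y - e z‖ := ENNReal.ofReal_mul (by positivity)
    _ ≤ ENNReal.ofReal (4 * a) * (4 * edist y z) := by
        gcongr
        exact H.controlled.le_edist _ hy _ hz (by linarith) (by linarith)
    _ = ENNReal.ofReal (16 * a) * edist y z := by
        rw [← mul_assoc]
        congr 1
        rw [show (4 : ℝ≥0∞) = ENNReal.ofReal 4 by simp, ← ENNReal.ofReal_mul (by positivity)]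
        congr 1
        ring

/-- A point of the local stable set stays in the domain of the chart in forward time, so that its
difference with `y` is a bounded forward orbit of the linear saddle. -/
theorem fiberStableSet_decay {ξ : ℤ → ι} {y z : M}
    (hy : (ξ, y) ∈ maximalInvariantSet φ (chartBall e θ))
    (hz : z ∈ fiberStableSet φ (ρ / 4) ξ y) :
    (e z).2 = (e y).2 ∧ ∀ n : ℕ, edist (fiberIterate φ n ξ y) (fiberIterate φ n ξ z)
      ≤ ENNReal.ofReal (16 * (1 + θ)⁻¹ ^ n) * edist y z := by
  have h0 := H.θ_pos
  have h1 := H.θ_le_radius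
  have hyn := H.norm_le_of_mem hy
  have hzn : ∀ n : ℕ, fiberIterate φ n ξ z ∈ e.source ∧ ‖e (fiberIterate φ n ξ z)‖ < R :=
    fun n => H.near_of_edist_le (hyn n).1 (hyn n).2 (hz n)
  let d : ℕ → SplitSpace s u := fun n => e (fiberIterate φ n ξ y) - e (fiberIterate φ n ξ z)
  have hd : ∀ n, d (n + 1) = affineSaddle θ 0 (d n) := by
    intro n
    simp only [d]
    push_cast
    rw [H.map_fiberIterate (hyn n).1 ((hyn n).2.trans (by linarith)),
      H.map_fiberIterate (hzn n).1 (hzn n).2.le, affineSaddle_sub]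
  have hdb : ∀ n, ‖d n‖ ≤ 2 * R := fun n =>
    (norm_sub_le _ _).trans (by linarith [(hyn n).2, (hzn n).2])
  have hsnd : (d 0).2 = 0 := forward_snd_eq_zero h0 hd hdb
  have hd0 : d 0 = e y - e z := by simp [d, fiberIterate_zero]
  have hy0 := hyn 0
  have hz0 := hzn 0
  rw [Nat.cast_zero] at hz0
  rw [fiberIterate_zero] at hy0 hz0
  refine ⟨?_, fun n => ?_⟩
  · rw [hd0, Prod.snd_sub, sub_eq_zero] at hsnd
    exact hsnd.symm
  · refine H.edist_le_of_decay hy0.1 hz0.1 (hyn n).1 (hzn n).1 (hy0.2.trans (by linarith)) hz0.2.le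
      ((hyn n).2.trans (by linarith)) (hzn n).2.le (by positivity) ?_
    rw [← hd0]
    exact norm_forward_le h0 H.θ_lt_one hd hsnd n

/-- A point of the local unstable set stays in the domain of the chart in backward time, so that its
difference with `y` is a bounded backward orbit of the linear saddle. -/
theorem fiberUnstableSet_decay {ξ : ℤ → ι} {y z : M}
    (hy : (ξ, y) ∈ maximalInvariantSet φ (chartBall e θ))
    (hz : z ∈ fiberUnstableSet φ (ρ / 4) ξ y) :
    (e z).1 = (e y).1 ∧ ∀ n : ℕ, edist (fiberIterate φ (-n) ξ y) (fiberIterate φ (-n) ξ z)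
      ≤ ENNReal.ofReal (16 * (1 + θ)⁻¹ ^ n) * edist y z := by
  have h0 := H.θ_pos
  have h1 := H.θ_le_radius
  have hyn := H.norm_le_of_mem hy
  have hzn : ∀ n : ℕ, fiberIterate φ (-n) ξ z ∈ e.source ∧ ‖e (fiberIterate φ (-n) ξ z)‖ < R :=
    fun n => H.near_of_edist_le (hyn _).1 (hyn _).2 (hz n)
  let d : ℕ → SplitSpace s u := fun n => e (fiberIterate φ (-n) ξ y) - e (fiberIterate φ (-n) ξ z)
  have hd : ∀ n, d n = affineSaddle θ 0 (d (n + 1)) := by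
    intro n
    have h : (-(n : ℤ)) = -((n + 1 : ℕ) : ℤ) + 1 := by push_cast; ring
    simp only [d]
    rw [h, H.map_fiberIterate (hyn _).1 ((hyn _).2.trans (by linarith)),
      H.map_fiberIterate (hzn (n + 1)).1 (hzn (n + 1)).2.le, affineSaddle_sub]
  have hdb : ∀ n, ‖d n‖ ≤ 2 * R := fun n =>
    (norm_sub_le _ _).trans (by linarith [(hyn (-n)).2, (hzn n).2])
  have hfst : (d 0).1 = 0 := backward_fst_eq_zero h0 H.θ_lt_one hd hdb
  have hd0 : d 0 = e y - e z := by simp [d, fiberIterate_zero]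
  have hy0 := hyn 0
  have hz0 := hzn 0
  rw [Nat.cast_zero, neg_zero] at hz0
  rw [fiberIterate_zero] at hy0 hz0
  refine ⟨?_, fun n => ?_⟩
  · rw [hd0, Prod.fst_sub, sub_eq_zero] at hfst
    exact hfst.symm
  · refine H.edist_le_of_decay hy0.1 hz0.1 (hyn _).1 (hzn n).1 (hy0.2.trans (by linarith)) hz0.2.le
      ((hyn _).2.trans (by linarith)) (hzn n).2.le (by positivity) ?_
    rw [← hd0]
    exact norm_backward_le h0 H.θ_lt_one hd hfst n

/-- Distances in the chart that are at most `ρ / 16` give distances at most `ρ / 4`. -/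
theorem edist_le_of_norm_sub_le {y z : M} (hy : y ∈ e.source) (hz : z ∈ e.source)
    (hyn : ‖e y‖ ≤ R) (hzn : ‖e z‖ ≤ R) (h : ‖e y - e z‖ ≤ ρ / 16) :
    edist y z ≤ ENNReal.ofReal (ρ / 4) := by
  have hR := H.controlled.radius_pos
  exact (H.controlled.edist_le _ hy _ hz (by linarith) (by linarith)).trans
    (ENNReal.ofReal_le_ofReal (by linarith))

/-- The points near `y` of the slice `ℝ^s` through `y` stay near the forward orbit of `y`. -/
theorem mem_fiberStableSet_of_snd_eq {ξ : ℤ → ι} {y z : M}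
    (hy : (ξ, y) ∈ maximalInvariantSet φ (chartBall e θ)) (hz : z ∈ e.source) {r' : ℝ}
    (hr : r' ≤ ρ / 16) (hrR : r' ≤ R / 2) (hd : ‖e z - e y‖ ≤ r') (h2 : (e z).2 = (e y).2) :
    z ∈ fiberStableSet φ (ρ / 4) ξ y := by
  have h0 := H.θ_pos
  have h1 := H.θ_le_radius
  have hθ1 := H.θ_lt_one
  have hyn := H.norm_le_of_mem hy
  have key : ∀ n : ℕ, fiberIterate φ n ξ z ∈ e.source ∧
      (e (fiberIterate φ n ξ z) - e (fiberIterate φ n ξ y)).2 = 0 ∧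
      ‖e (fiberIterate φ n ξ z) - e (fiberIterate φ n ξ y)‖ ≤ r' := by
    intro n
    induction n with
    | zero =>
      rw [Nat.cast_zero, fiberIterate_zero, fiberIterate_zero]
      exact ⟨hz, by rw [Prod.snd_sub, h2, sub_self], hd⟩
    | succ n ih =>
      obtain ⟨i1, i2, i3⟩ := ih
      have hzR : ‖e (fiberIterate φ n ξ z)‖ ≤ R := by
        have := norm_le_norm_add_norm_sub' (e (fiberIterate φ n ξ z)) (e (fiberIterate φ n ξ y))
        linarith [(hyn n).2]
      have hstep : e (fiberIterate φ (n + 1 : ℕ) ξ z) - e (fiberIterate φ (n + 1 : ℕ) ξ y)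
          = affineSaddle θ 0 (e (fiberIterate φ n ξ z) - e (fiberIterate φ n ξ y)) := by
        push_cast
        rw [H.map_fiberIterate i1 hzR, H.map_fiberIterate (hyn n).1 ((hyn n).2.trans (by linarith)),
          affineSaddle_sub]
      have hs2 : (e (fiberIterate φ (n + 1 : ℕ) ξ z) - e (fiberIterate φ (n + 1 : ℕ) ξ y)).2 = 0 := by
        rw [hstep, affineSaddle_zero_snd, i2, smul_zero]
      refine ⟨?_, hs2, ?_⟩
      · push_cast
        rw [fiberIterate_add_one]
        exact H.map_mem _ _ i1 hzR
      · rw [Prod.norm_def, hs2, norm_zero]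
        refine max_le ?_ ((norm_nonneg _).trans i3)
        rw [hstep, affineSaddle_zero_fst, norm_smul, Real.norm_of_nonneg (by linarith)]
        refine (mul_le_of_le_one_left (norm_nonneg _) (by linarith)).trans ?_
        exact (norm_fst_le _).trans i3
  intro n
  obtain ⟨i1, -, i3⟩ := key n
  have hzR : ‖e (fiberIterate φ n ξ z)‖ ≤ R := by
    have := norm_le_norm_add_norm_sub' (e (fiberIterate φ n ξ z)) (e (fiberIterate φ n ξ y))
    linarith [(hyn n).2]
  refine H.edist_le_of_norm_sub_le (hyn n).1 i1 ((hyn n).2.trans (by linarith)) hzR ?_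
  rw [norm_sub_rev]
  exact i3.trans hr

/-- The points near `y` of the slice `ℝ^u` through `y` stay near the backward orbit of `y`. -/
theorem mem_fiberUnstableSet_of_fst_eq {ξ : ℤ → ι} {y z : M}
    (hy : (ξ, y) ∈ maximalInvariantSet φ (chartBall e θ)) (hz : z ∈ e.source) {r' : ℝ}
    (hr : r' ≤ ρ / 16) (hrR : r' ≤ R / 2) (hd : ‖e z - e y‖ ≤ r') (h2 : (e z).1 = (e y).1) :
    z ∈ fiberUnstableSet φ (ρ / 4) ξ y := by
  have h0 := H.θ_pos
  have h1 := H.θ_le_radius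
  have hyn := H.norm_le_of_mem hy
  -- the backward orbit of `z` is found by contracting the difference with `y`
  have key : ∀ n : ℕ, fiberIterate φ (-n) ξ z ∈ e.source ∧
      (e (fiberIterate φ (-n) ξ z) - e (fiberIterate φ (-n) ξ y)).1 = 0 ∧
      ‖e (fiberIterate φ (-n) ξ z) - e (fiberIterate φ (-n) ξ y)‖ ≤ r' := by
    intro n
    induction n with
    | zero =>
      rw [Nat.cast_zero, neg_zero, fiberIterate_zero, fiberIterate_zero]
      exact ⟨hz, by rw [Prod.fst_sub, h2, sub_self], hd⟩
    | succ n ih =>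
      obtain ⟨i1, i2, i3⟩ := ih
      let m : ℤ := -((n + 1 : ℕ) : ℤ)
      have hm : m + 1 = -(n : ℤ) := by simp only [m]; push_cast; ring
      let d : SplitSpace s u :=
        (0, (1 + θ)⁻¹ • (e (fiberIterate φ (-n) ξ z) - e (fiberIterate φ (-n) ξ y)).2)
      have hdn : ‖d‖ ≤ r' := by
        refine max_le (by simpa [d] using (norm_nonneg _).trans i3) ?_
        rw [norm_smul, Real.norm_of_nonneg (inv_nonneg.2 (by linarith))]
        refine (mul_le_of_le_one_left (norm_nonneg _)
          (inv_le_one_of_one_le₀ (by linarith))).trans ?_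
        exact (norm_snd_le _).trans i3
      have hAd : affineSaddle θ 0 d = e (fiberIterate φ (-n) ξ z) - e (fiberIterate φ (-n) ξ y) := by
        refine Prod.ext ?_ ?_
        · rw [affineSaddle_zero_fst, i2, smul_zero]
        · rw [affineSaddle_zero_snd, smul_smul, mul_inv_cancel₀ (by linarith), one_smul]
      let w : SplitSpace s u := e (fiberIterate φ m ξ y) + d
      have hwR : ‖w‖ ≤ R := (norm_add_le _ _).trans (by linarith [(hyn m).2])
      have hwt : w ∈ e.target := H.closedBall_subset le_rfl (by simpa using hwR)
      have hws := e.map_target hwt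
      have hwe := e.right_inv hwt
      have hφw : φ (ξ m) (e.symm w) = fiberIterate φ (-n) ξ z := by
        have hsR : ‖e (e.symm w)‖ ≤ R := by rw [hwe]; exact hwR
        rw [← e.left_inv i1, ← e.left_inv (H.map_mem (ξ m) _ hws hsR), H.map_eq _ _ hws hsR, hwe]
        congr 1
        have h3 : affineSaddle θ (v (ξ m)) w - affineSaddle θ (v (ξ m)) (e (fiberIterate φ m ξ y))
            = e (fiberIterate φ (-n) ξ z) - e (fiberIterate φ (-n) ξ y) := by
          rw [affineSaddle_sub, ← hAd]
          simp [w]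
        rw [← H.map_fiberIterate (hyn m).1 ((hyn m).2.trans (by linarith)), hm] at h3
        exact sub_left_injective h3
      have hwz : fiberIterate φ m ξ z = e.symm w := by
        apply (φ (ξ m)).injective
        rw [← fiberIterate_add_one, hm, hφw]
      have hdiff : e (fiberIterate φ m ξ z) - e (fiberIterate φ m ξ y) = d := by
        rw [hwz, hwe]; simp [w]
      change fiberIterate φ m ξ z ∈ e.source ∧
        (e (fiberIterate φ m ξ z) - e (fiberIterate φ m ξ y)).1 = 0 ∧
        ‖e (fiberIterate φ m ξ z) - e (fiberIterate φ m ξ y)‖ ≤ r'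
      rw [hdiff, hwz]
      exact ⟨hws, rfl, hdn⟩
  intro n
  obtain ⟨i1, -, i3⟩ := key n
  have hzR : ‖e (fiberIterate φ (-n) ξ z)‖ ≤ R := by
    have := norm_le_norm_add_norm_sub' (e (fiberIterate φ (-n) ξ z)) (e (fiberIterate φ (-n) ξ y))
    linarith [(hyn (-n)).2]
  refine H.edist_le_of_norm_sub_le (hyn _).1 i1 ((hyn _).2.trans (by linarith)) hzR ?_
  rw [norm_sub_rev]
  exact i3.trans hr

/-- The local product structure is given by restrictions of the one chart `e` to balls around the
points of the maximal invariant set. -/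
theorem isTopologicallyHyperbolic :
    IsTopologicallyHyperbolic φ (maximalInvariantSet φ (chartBall e θ)) s u := by
  have h0 := H.θ_pos
  have h1 := H.θ_le_radius
  have hρ := H.controlled.ρ_pos
  have hR := H.controlled.radius_pos
  let r' : ℝ := min (ρ / 16) (R / 2)
  have hr' : 0 < r' := lt_min (by linarith) (by linarith)
  have hr1 : r' ≤ ρ / 16 := min_le_left _ _
  have hr2 : r' ≤ R / 2 := min_le_right _ _
  refine ⟨ρ / 4, 16, (1 + θ)⁻¹, r' / 4, by positivity, by norm_num, inv_pos.2 (by linarith),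
    inv_lt_one_of_one_lt₀ (by linarith), by positivity, fun ξ y hy => ⟨?_, ?_, ?_⟩⟩
  · intro z hz n
    exact (H.fiberStableSet_decay hy hz).2 n
  · intro z hz n
    exact (H.fiberUnstableSet_decay hy hz).2 n
  · have hy0 := H.norm_le_of_mem hy 0
    rw [fiberIterate_zero] at hy0
    have hopen : IsOpen (e.source ∩ e ⁻¹' Metric.ball (e y) r') :=
      e.isOpen_inter_preimage Metric.isOpen_ball
    refine ⟨e.restrOpen _ hopen, ?_, ?_⟩
    · intro z hz
      rw [Metric.mem_eball, edist_comm] at hz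
      have hz1 := H.near_of_edist_le hy0.1 hy0.2
        (hz.le.trans (ENNReal.ofReal_le_ofReal (by linarith)))
      refine ⟨hz1.1, hz1.1, ?_⟩
      rw [mem_preimage, mem_ball_iff_norm]
      have h3 := H.controlled.le_edist z hz1.1 y hy0.1 (by linarith [hz1.2]) (by linarith)
      have h4 : ENNReal.ofReal ‖e z - e y‖ < ENNReal.ofReal r' := by
        refine h3.trans_lt ?_
        calc 4 * edist z y < 4 * ENNReal.ofReal (r' / 4) := by
              rw [edist_comm]
              exact ENNReal.mul_lt_mul_right (by simp) (by simp) hz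
          _ = ENNReal.ofReal r' := by
              rw [show (4 : ℝ≥0∞) = ENNReal.ofReal 4 by simp, ← ENNReal.ofReal_mul (by norm_num)]
              congr 1
              ring
      exact (ENNReal.ofReal_lt_ofReal_iff hr').1 h4
    · rintro z ⟨hz, -, hzb⟩
      rw [mem_preimage, mem_ball_iff_norm] at hzb
      exact ⟨⟨fun h => (H.fiberStableSet_decay hy h).1,
          fun h => H.mem_fiberStableSet_of_snd_eq hy hz hr1 hr2 hzb.le h⟩,
        ⟨fun h => (H.fiberUnstableSet_decay hy h).1,
          fun h => H.mem_fiberUnstableSet_of_fst_eq hy hz hr1 hr2 hzb.le h⟩⟩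

end IsLocalSaddle

end LocalHyperbolicity

/-! ### The hyperbolic splitting of the tangent spaces -/

section DifferentiableHyperbolicity

variable {c : ℕ} {M : Type*} [EMetricSpace M] [ChartedSpace (EuclideanSpace ℝ (Fin c)) M]
  {ι : Type*} {s u : ℕ}

/-- The tangent vectors at `y` that the chart maps into `ℝ^s`. -/
noncomputable def stableSpace (e : OpenPartialHomeomorph M (SplitSpace s u)) (y : M) :
    Submodule ℝ (TangentSpace (𝓡 c) y) :=
  LinearMap.ker (LinearMap.snd ℝ _ _ ∘ₗ (vectorDeriv (c := c) e y).toLinearMap)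

/-- The tangent vectors at `y` that the chart maps into `ℝ^u`. -/
noncomputable def unstableSpace (e : OpenPartialHomeomorph M (SplitSpace s u)) (y : M) :
    Submodule ℝ (TangentSpace (𝓡 c) y) :=
  LinearMap.ker (LinearMap.fst ℝ _ _ ∘ₗ (vectorDeriv (c := c) e y).toLinearMap)

theorem mem_stableSpace {e : OpenPartialHomeomorph M (SplitSpace s u)} {y : M}
    {v : TangentSpace (𝓡 c) y} :
    v ∈ stableSpace (c := c) e y ↔ (vectorDeriv (c := c) e y v).2 = 0 := Iff.rfl

theorem mem_unstableSpace {e : OpenPartialHomeomorph M (SplitSpace s u)} {y : M}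
    {v : TangentSpace (𝓡 c) y} :
    v ∈ unstableSpace (c := c) e y ↔ (vectorDeriv (c := c) e y v).1 = 0 := Iff.rfl

theorem isCompl_stableSpace {e : OpenPartialHomeomorph M (SplitSpace s u)} {y : M}
    (hb : Function.Bijective (vectorDeriv (c := c) e y)) :
    IsCompl (stableSpace (c := c) e y) (unstableSpace (c := c) e y) := by
  constructor
  · rw [Submodule.disjoint_def]
    intro v h1 h2
    exact hb.1 ((Prod.ext h2 h1 : vectorDeriv (c := c) e y v = 0).trans (map_zero _).symm)
  · rw [codisjoint_iff, eq_top_iff]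
    intro v _
    obtain ⟨a, ha⟩ := hb.2 ((vectorDeriv (c := c) e y v).1, 0)
    refine Submodule.mem_sup.2 ⟨a, ?_, v - a, ?_, by abel⟩
    · rw [mem_stableSpace, ha]
    · rw [mem_unstableSpace, map_sub, ha, Prod.fst_sub, sub_self]

theorem finrank_stableSpace {e : OpenPartialHomeomorph M (SplitSpace s u)} {y : M}
    (hsu : s + u = c) (hb : Function.Bijective (vectorDeriv (c := c) e y)) :
    Module.finrank ℝ (stableSpace (c := c) e y) = s ∧
      Module.finrank ℝ (unstableSpace (c := c) e y) = u := by
  have : FiniteDimensional ℝ (TangentSpace (𝓡 c) y) :=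
    inferInstanceAs (FiniteDimensional ℝ (EuclideanSpace ℝ (Fin c)))
  have hc : Module.finrank ℝ (TangentSpace (𝓡 c) y) = c :=
    (finrank_euclideanSpace_fin : Module.finrank ℝ (EuclideanSpace ℝ (Fin c)) = c)
  have h1 := LinearMap.finrank_range_add_finrank_ker (LinearMap.snd ℝ (EuclideanSpace ℝ (Fin s))
    (EuclideanSpace ℝ (Fin u)) ∘ₗ (vectorDeriv (c := c) e y).toLinearMap)
  have h2 := LinearMap.finrank_range_add_finrank_ker (LinearMap.fst ℝ (EuclideanSpace ℝ (Fin s))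
    (EuclideanSpace ℝ (Fin u)) ∘ₗ (vectorDeriv (c := c) e y).toLinearMap)
  have h3 : Function.Surjective (LinearMap.snd ℝ (EuclideanSpace ℝ (Fin s))
      (EuclideanSpace ℝ (Fin u)) ∘ₗ (vectorDeriv (c := c) e y).toLinearMap) :=
    fun w => (hb.2 (0, w)).imp fun _ hz => congrArg Prod.snd hz
  have h4 : Function.Surjective (LinearMap.fst ℝ (EuclideanSpace ℝ (Fin s))
      (EuclideanSpace ℝ (Fin u)) ∘ₗ (vectorDeriv (c := c) e y).toLinearMap) :=
    fun w => (hb.2 (w, 0)).imp fun _ hz => congrArg Prod.fst hz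
  rw [LinearMap.range_eq_top.2 h3, finrank_top,
    finrank_euclideanSpace_fin, hc] at h1
  rw [LinearMap.range_eq_top.2 h4, finrank_top,
    finrank_euclideanSpace_fin, hc] at h2
  change u + Module.finrank ℝ (stableSpace (c := c) e y) = c at h1
  change s + Module.finrank ℝ (unstableSpace (c := c) e y) = c at h2
  omega

variable [RiemannianBundle (fun x : M => TangentSpace (𝓡 c) x)]

theorem IsControlled.bijective_vectorDeriv (hsu : s + u = c) {x : M}
    {e : OpenPartialHomeomorph M (SplitSpace s u)} {q R ρ : ℝ}
    (h : IsControlled (c := c) x e q R ρ) {y : M} (hy : y ∈ e.source) (hyn : ‖e y‖ ≤ 3 * R) :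
    Function.Bijective (vectorDeriv (c := c) e y) := by
  have : FiniteDimensional ℝ (TangentSpace (𝓡 c) y) :=
    inferInstanceAs (FiniteDimensional ℝ (EuclideanSpace ℝ (Fin c)))
  have hinj : Function.Injective (vectorDeriv (c := c) e y).toLinearMap := by
    rw [← LinearMap.ker_eq_bot, LinearMap.ker_eq_bot']
    intro v hv
    have h1 := h.norm_le_mul y hy hyn v
    have h2 : vectorDeriv (c := c) e y v = 0 := hv
    have h3 : l2norm (0 : SplitSpace s u) = 0 := norm_zero (E := WithLp 2 (SplitSpace s u))
    rw [h2, h3, mul_zero] at h1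
    exact norm_le_zero_iff.1 h1
  have hfin : Module.finrank ℝ (TangentSpace (𝓡 c) y) = Module.finrank ℝ (SplitSpace s u) := by
    have h1 : Module.finrank ℝ (TangentSpace (𝓡 c) y) = c :=
      (finrank_euclideanSpace_fin : Module.finrank ℝ (EuclideanSpace ℝ (Fin c)) = c)
    rw [h1]; simp [hsu]
  exact ⟨hinj, (LinearMap.injective_iff_surjective_of_finrank_eq_finrank hfin).1 hinj⟩

namespace IsLocalSaddle

variable {x : M} {e : OpenPartialHomeomorph M (SplitSpace s u)} {q R ρ θ : ℝ}
  {v : ι → SplitSpace s u} {φ : ι → M ≃ M} (H : IsLocalSaddle (c := c) x e q R ρ θ v φ)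
include H

/-- In the chart, the derivatives of the maps `φ i` near `x` are the linear saddle. -/
theorem vectorDeriv_map (he : ContMDiffOn (𝓡 c) 𝓘(ℝ, SplitSpace s u) ∞ e e.source)
    {i : ι} (hd : MDifferentiable (𝓡 c) (𝓡 c) (φ i)) {y : M} (hy : y ∈ e.source)
    (hyn : ‖e y‖ < R) (w : TangentSpace (𝓡 c) y) :
    vectorDeriv (c := c) e (φ i y) (mfderiv (𝓡 c) (𝓡 c) (φ i) y w)
      = affineSaddle θ 0 (vectorDeriv (c := c) e y w) := by
  rw [vectorDeriv_mfderiv he (hd y) hy (H.map_mem i y hy hyn.le)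
    (hasFDerivAt_affineSaddle θ (v i) _).differentiableAt ?_, fderiv_affineSaddle]
  have h1 : ∀ᶠ z in 𝓝 y, z ∈ e.source := e.open_source.mem_nhds hy
  have h2 : ∀ᶠ z in 𝓝 y, ‖e z‖ < R := (e.continuousAt hy).norm.eventually_lt_const hyn
  filter_upwards [h1, h2] with z hz1 hz2
  exact H.map_eq i z hz1 hz2.le

/-- The invariant splitting is the preimage under the derivative of the chart of the splitting of
`ℝ^s × ℝ^u`; in particular it does not depend on `ξ`. -/
theorem isDifferentiablyHyperbolic (hsu : s + u = c)
    (he : ContMDiffOn (𝓡 c) 𝓘(ℝ, SplitSpace s u) ∞ e e.source) (hq : 0 < q)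
    (hd : ∀ i, MDifferentiable (𝓡 c) (𝓡 c) (φ i))
    (hd' : ∀ i, MDifferentiable (𝓡 c) (𝓡 c) (φ i).symm) :
    IsDifferentiablyHyperbolic (c := c) φ (maximalInvariantSet φ (chartBall e θ)) s u := by
  have h0 := H.θ_pos
  have h1 := H.θ_le_radius
  have hR := H.controlled.radius_pos
  have hbij : ∀ y ∈ e.source, ‖e y‖ ≤ R → Function.Bijective (vectorDeriv (c := c) e y) :=
    fun y hy hyn => H.controlled.bijective_vectorDeriv hsu hy (by linarith)
  have hfun : ∀ (ξ : ℤ → ι) (n : ℤ),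
      fiberIterate φ (n + 1) ξ = φ (ξ n) ∘ fiberIterate φ n ξ := fun ξ n =>
    funext fun y => fiberIterate_add_one φ n ξ y
  have hdi : ∀ (ξ : ℤ → ι) (n : ℤ), MDifferentiable (𝓡 c) (𝓡 c) (fiberIterate φ n ξ) := by
    intro ξ n
    induction n using Int.induction_on with
    | zero =>
      rw [show fiberIterate φ 0 ξ = id from funext fun y => fiberIterate_zero φ ξ y]
      exact mdifferentiable_id
    | succ n ih => rw [hfun]; exact (hd _).comp ih
    | pred n ih =>
      have : fiberIterate φ (-(n : ℤ) - 1) ξ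
          = (φ (ξ (-(n : ℤ) - 1))).symm ∘ fiberIterate φ (-n) ξ := by
        have h2 := hfun ξ (-(n : ℤ) - 1)
        rw [sub_add_cancel] at h2
        rw [h2]
        ext y
        simp
      rw [this]
      exact (hd' _).comp ih
  -- the norm of a tangent vector is comparable with its norm in the chart
  have hnorm : ∀ {y y' : M}, y ∈ e.source → ‖e y‖ ≤ R → y' ∈ e.source → ‖e y'‖ ≤ R →
      ∀ (w : TangentSpace (𝓡 c) y) (w' : TangentSpace (𝓡 c) y') (b : ℝ), 0 ≤ b →
      ‖vectorDeriv (c := c) e y' w'‖ ≤ b * ‖vectorDeriv (c := c) e y w‖ →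
      ‖w'‖ ≤ 2 * q ^ 2 * b * ‖w‖ := by
    intro y y' hy hyn hy' hyn' w w' b hb h
    calc ‖w'‖ ≤ q * l2norm (vectorDeriv (c := c) e y' w') :=
          H.controlled.norm_le_mul y' hy' (by linarith) w'
      _ ≤ q * (2 * (b * ‖vectorDeriv (c := c) e y w‖)) := by
          gcongr
          exact (l2norm_le_two_mul _).trans (by gcongr)
      _ ≤ q * (2 * (b * (q * ‖w‖))) := by
          gcongr
          exact (norm_le_l2norm _).trans (H.controlled.le_mul_norm y hy (by linarith) w)
      _ = 2 * q ^ 2 * b * ‖w‖ := by ring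
  refine ⟨fun _ y => stableSpace (c := c) e y, fun _ y => unstableSpace (c := c) e y, 2 * q ^ 2,
    (1 + θ)⁻¹, by positivity, by positivity, inv_lt_one_of_one_lt₀ (by linarith),
    fun ξ y hy => ?_⟩
  have hyn := H.norm_le_of_mem hy
  have hy0 := hyn 0
  rw [fiberIterate_zero] at hy0
  have hy1 := hyn 1
  rw [← zero_add (1 : ℤ), fiberIterate_add_one, fiberIterate_zero] at hy1
  have hb0 := hbij y hy0.1 (hy0.2.trans (by linarith))
  have hb1 := hbij _ hy1.1 (hy1.2.trans (by linarith))
  have hmap := H.vectorDeriv_map he (hd (ξ 0)) hy0.1 (hy0.2.trans_lt (by linarith))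
  -- `a w n` is the image of `w` under the derivative of the `n`-th iterate, read in the chart
  let a : TangentSpace (𝓡 c) y → ℤ → SplitSpace s u := fun w n =>
    vectorDeriv (c := c) e (fiberIterate φ n ξ y)
      (mfderiv (𝓡 c) (𝓡 c) (fiberIterate φ n ξ) y w)
  have ha : ∀ w n, a w (n + 1) = affineSaddle θ 0 (a w n) := by
    intro w n
    simp only [a]
    rw [← H.vectorDeriv_map he (hd (ξ n)) (hyn n).1 ((hyn n).2.trans_lt (by linarith)), hfun,
      mfderiv_comp y (hd _ _) (hdi ξ n y)]
    rfl
  have ha0 : ∀ w, a w 0 = vectorDeriv (c := c) e y w := by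
    intro w
    simp only [a]
    rw [show fiberIterate φ 0 ξ = id from funext fun y => fiberIterate_zero φ ξ y, mfderiv_id]
    rfl
  obtain ⟨hf1, hf2⟩ := finrank_stableSpace hsu hb0
  refine ⟨isCompl_stableSpace hb0, hf1, hf2, ?_, ?_, ?_, ?_⟩
  · ext w
    constructor
    · rintro ⟨w, hw, rfl⟩
      refine mem_stableSpace.2 ?_
      change (vectorDeriv (c := c) e (φ (ξ 0) y) (mfderiv (𝓡 c) (𝓡 c) (φ (ξ 0)) y w)).2 = 0
      rw [hmap, affineSaddle_zero_snd, mem_stableSpace.1 hw, smul_zero]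
    · intro hw
      obtain ⟨w', hw'⟩ := hb0.2 ((1 - θ)⁻¹ • (vectorDeriv (c := c) e (φ (ξ 0) y) w).1, 0)
      refine ⟨w', ?_, hb1.1 ?_⟩
      · exact mem_stableSpace.2 (by rw [hw'])
      · change vectorDeriv (c := c) e (φ (ξ 0) y) (mfderiv (𝓡 c) (𝓡 c) (φ (ξ 0)) y w') = _
        rw [hmap, hw']
        refine Prod.ext ?_ ?_
        · rw [affineSaddle_zero_fst, smul_smul, mul_inv_cancel₀ (by linarith [H.θ_lt_one]), one_smul]
        · rw [affineSaddle_zero_snd, smul_zero]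
          exact (mem_stableSpace.1 hw).symm
  · ext w
    constructor
    · rintro ⟨w, hw, rfl⟩
      refine mem_unstableSpace.2 ?_
      change (vectorDeriv (c := c) e (φ (ξ 0) y) (mfderiv (𝓡 c) (𝓡 c) (φ (ξ 0)) y w)).1 = 0
      rw [hmap, affineSaddle_zero_fst, mem_unstableSpace.1 hw, smul_zero]
    · intro hw
      obtain ⟨w', hw'⟩ := hb0.2 (0, (1 + θ)⁻¹ • (vectorDeriv (c := c) e (φ (ξ 0) y) w).2)
      refine ⟨w', ?_, hb1.1 ?_⟩
      · exact mem_unstableSpace.2 (by rw [hw'])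
      · change vectorDeriv (c := c) e (φ (ξ 0) y) (mfderiv (𝓡 c) (𝓡 c) (φ (ξ 0)) y w') = _
        rw [hmap, hw']
        refine Prod.ext ?_ ?_
        · rw [affineSaddle_zero_fst, smul_zero]
          exact (mem_unstableSpace.1 hw).symm
        · rw [affineSaddle_zero_snd, smul_smul, mul_inv_cancel₀ (by linarith), one_smul]
  · intro w hw n
    have h2 := norm_forward_le h0 H.θ_lt_one (a := fun n : ℕ => a w n) (fun n => ha w n)
      (by simp only [Nat.cast_zero]; rw [ha0]; exact mem_stableSpace.1 hw) n
    simp only [Nat.cast_zero] at h2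
    rw [ha0] at h2
    exact hnorm hy0.1 (hy0.2.trans (by linarith)) (hyn n).1 ((hyn n).2.trans (by linarith)) w _ _
      (by positivity) h2
  · intro w hw n
    have h2 := norm_backward_le h0 H.θ_lt_one (b := fun n : ℕ => a w (-n))
      (fun n => by rw [← ha]; congr 1; push_cast; ring)
      (by simp only [Nat.cast_zero, neg_zero]; rw [ha0]; exact mem_unstableSpace.1 hw) n
    simp only [Nat.cast_zero, neg_zero] at h2
    rw [ha0] at h2
    exact hnorm hy0.1 (hy0.2.trans (by linarith)) (hyn _).1 ((hyn _).2.trans (by linarith)) w _ _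
      (by positivity) h2

end IsLocalSaddle

end DifferentiableHyperbolicity

/-! ### Distortion of maps supported in a chart -/

section Distortion

variable {c : ℕ} {M : Type*} [EMetricSpace M] [ChartedSpace (EuclideanSpace ℝ (Fin c)) M]
  [RiemannianBundle (fun x : M => TangentSpace (𝓡 c) x)]

/-- A lower bound for the derivative of a map is an upper bound for the derivative of its
inverse. -/
theorem norm_mfderiv_inverse_le {f g : M → M} (hf : MDifferentiable (𝓡 c) (𝓡 c) f)
    (hg : MDifferentiable (𝓡 c) (𝓡 c) g) (hfg : f ∘ g = id) {C : ℝ}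
    (h : ∀ (y : M) (w : TangentSpace (𝓡 c) y), ‖w‖ ≤ C * ‖mfderiv (𝓡 c) (𝓡 c) f y w‖)
    (z : M) (w : TangentSpace (𝓡 c) z) : ‖mfderiv (𝓡 c) (𝓡 c) g z w‖ ≤ C * ‖w‖ := by
  have hid : ∀ F : M → M, F = id → ‖mfderiv (𝓡 c) (𝓡 c) F z w‖ = ‖w‖ := by
    rintro _ rfl
    rw [mfderiv_id]
    rfl
  have h1 := hid _ hfg
  rw [mfderiv_comp z (hf _) (hg z)] at h1
  exact (h (g z) (mfderiv (𝓡 c) (𝓡 c) g z w)).trans_eq (congrArg (C * ·) h1)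

variable {s u : ℕ} {x : M} {e : OpenPartialHomeomorph M (SplitSpace s u)} {q R ρ : ℝ}

/-- If a chart is almost isometric and `g` is `C^1`-close to the identity, then the extension of
`g` to the manifold is almost isometric. -/
theorem IsControlled.norm_mfderiv_extendByChart (h : IsControlled (c := c) x e q R ρ) (hq : 1 < q)
    (he : ContMDiffOn (𝓡 c) 𝓘(ℝ, SplitSpace s u) ∞ e e.source)
    (he' : ContMDiffOn 𝓘(ℝ, SplitSpace s u) (𝓡 c) ∞ e.symm e.target)
    {g : SplitSpace s u → SplitSpace s u} (hg : ContDiff ℝ ∞ g) (hinj : g.Injective)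
    (hK : ∀ w, w ∉ Metric.closedBall 0 (2 * R) → g w = w) {τ : ℝ} (hτ : 2 * τ ≤ 1 - q⁻¹)
    (hgτ : ∀ w, ‖fderiv ℝ g w - ContinuousLinearMap.id ℝ _‖ ≤ τ) (y : M)
    (w : TangentSpace (𝓡 c) y) :
    ‖mfderiv (𝓡 c) (𝓡 c) (extendByChart e g) y w‖ ≤ q ^ 3 * ‖w‖ ∧
      ‖w‖ ≤ q ^ 3 * ‖mfderiv (𝓡 c) (𝓡 c) (extendByChart e g) y w‖ := by
  have hR := h.radius_pos
  have hKt : Metric.closedBall 0 (2 * R) ⊆ e.target :=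
    (Metric.closedBall_subset_closedBall (by linarith)).trans h.closedBall_subset
  have hKc : IsCompact (Metric.closedBall (0 : SplitSpace s u) (2 * R)) := isCompact_closedBall _ _
  by_cases hy : y ∈ e.symm '' Metric.closedBall 0 (2 * R)
  · have hy1 : y ∈ e.source ∧ e y ∈ Metric.closedBall 0 (2 * R) := by
      obtain ⟨z, hz, rfl⟩ := hy
      exact ⟨e.map_target (hKt hz), by rwa [e.right_inv (hKt hz)]⟩
    obtain ⟨hys, hz⟩ := hy1
    have hgz : g (e y) ∈ Metric.closedBall 0 (2 * R) :=
      mapsTo_target_of_injective hinj Subset.rfl hK hz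
    have hfy : extendByChart e g y = e.symm (g (e y)) := extendByChart_of_mem hys
    have hfys : extendByChart e g y ∈ e.source := by rw [hfy]; exact e.map_target (hKt hgz)
    have hefy : ‖e (extendByChart e g y)‖ ≤ 3 * R := by
      rw [hfy, e.right_inv (hKt hgz)]
      have : ‖g (e y)‖ ≤ 2 * R := by simpa using hgz
      linarith
    have heyn : ‖e y‖ ≤ 3 * R := by
      have : ‖e y‖ ≤ 2 * R := by simpa using hz
      linarith
    have hsm := contMDiff_extendByChart he he' hg hinj hKc hKt hK
    have hconj : (e ∘ extendByChart e g : M → SplitSpace s u) =ᶠ[𝓝 y] g ∘ e := by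
      filter_upwards [e.open_source.mem_nhds hys] with p hp
      rw [Function.comp_apply, extendByChart_of_mem hp, e.right_inv]
      · rfl
      · exact mapsTo_target_of_injective hinj hKt hK (e.map_source hp)
    have hD := vectorDeriv_mfderiv (c := c) he (hsm.mdifferentiable (by simp) y) hys hfys
      (hg.differentiable (by simp) _) hconj w
    set a := vectorDeriv (c := c) e y w
    set b := vectorDeriv (c := c) e (extendByChart e g y)
      (mfderiv (𝓡 c) (𝓡 c) (extendByChart e g) y w)
    -- the derivative of `g` is close to the identity
    have hab : l2norm (b - a) ≤ 2 * τ * l2norm a ∧ l2norm (a - b) ≤ 2 * τ * l2norm a := by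
      have h1 : ‖b - a‖ ≤ τ * l2norm a := by
        rw [hD]
        calc ‖fderiv ℝ g (e y) a - a‖
            = ‖(fderiv ℝ g (e y) - ContinuousLinearMap.id ℝ (SplitSpace s u)) a‖ := by simp
          _ ≤ ‖fderiv ℝ g (e y) - ContinuousLinearMap.id ℝ _‖ * ‖a‖ :=
              ContinuousLinearMap.le_opNorm _ _
          _ ≤ τ * l2norm a :=
              mul_le_mul (hgτ _) (norm_le_l2norm _) (norm_nonneg _) ((norm_nonneg _).trans (hgτ 0))
      have h2 : ‖a - b‖ ≤ τ * l2norm a := by rwa [norm_sub_rev]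
      exact ⟨(l2norm_le_two_mul _).trans (by linarith), (l2norm_le_two_mul _).trans (by linarith)⟩
    have ha0 : 0 ≤ l2norm a := norm_nonneg _
    have hb0 : 0 ≤ l2norm b := norm_nonneg _
    have hqi : q * q⁻¹ = 1 := mul_inv_cancel₀ (by linarith)
    have hτa : 2 * τ * l2norm a ≤ (1 - q⁻¹) * l2norm a := by gcongr
    have hba : l2norm b ≤ q * l2norm a := by
      have h1 := l2norm_add_le a (b - a)
      rw [add_sub_cancel] at h1
      have h2 : 2 - q⁻¹ ≤ q := by
        have : 0 ≤ q⁻¹ * (q - 1) ^ 2 := by positivity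
        nlinarith
      nlinarith [hab.1]
    have hab' : l2norm a ≤ q * l2norm b := by
      have h1 := l2norm_add_le b (a - b)
      rw [add_sub_cancel] at h1
      have h2 : q⁻¹ * l2norm a ≤ l2norm b := by linarith [hab.2]
      calc l2norm a = q * (q⁻¹ * l2norm a) := by rw [← mul_assoc, hqi, one_mul]
        _ ≤ q * l2norm b := by gcongr
    have ha1 := h.le_mul_norm y hys heyn w
    have ha2 := h.norm_le_mul y hys heyn w
    have hb1 := h.le_mul_norm _ hfys hefy (mfderiv (𝓡 c) (𝓡 c) (extendByChart e g) y w)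
    have hb2 := h.norm_le_mul _ hfys hefy (mfderiv (𝓡 c) (𝓡 c) (extendByChart e g) y w)
    constructor
    · calc _ ≤ q * l2norm b := hb2
        _ ≤ q * (q * (q * ‖w‖)) := by gcongr; exact hba.trans (by gcongr)
        _ = q ^ 3 * ‖w‖ := by ring
    · calc ‖w‖ ≤ q * l2norm a := ha2
        _ ≤ q * (q * (q * ‖mfderiv (𝓡 c) (𝓡 c) (extendByChart e g) y w‖)) := by
            gcongr; exact hab'.trans (by gcongr)
        _ = _ := by ring
  · have hev : extendByChart e g =ᶠ[𝓝 y] id := by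
      filter_upwards [(isClosed_symm_image hKc hKt).isOpen_compl.mem_nhds
        (show y ∈ (e.symm '' Metric.closedBall 0 (2 * R))ᶜ from hy)] with p hp
      exact extendByChart_eq_self hK hp
    have h1 : ‖mfderiv (𝓡 c) (𝓡 c) (extendByChart e g) y w‖ = ‖w‖ := by
      have h2 : extendByChart e g y = y := hev.self_of_nhds
      have h3 := hev.mfderiv_eq (I := 𝓡 c) (I' := 𝓡 c)
      have key : ∀ (z : M), z = y → ∀ T : TangentSpace (𝓡 c) y →L[ℝ] TangentSpace (𝓡 c) z,
          HEq T (ContinuousLinearMap.id ℝ (TangentSpace (𝓡 c) y)) → ‖T w‖ = ‖w‖ := by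
        rintro _ rfl T hT
        rw [eq_of_heq hT]
        rfl
      refine key _ h2 _ ?_
      exact heq_of_eq (h3.trans mfderiv_id)
    have h2 : 1 ≤ q ^ 3 := one_le_pow₀ hq.le
    rw [h1]
    exact ⟨le_mul_of_one_le_left (norm_nonneg _) h2, le_mul_of_one_le_left (norm_nonneg _) h2⟩

variable [IsRiemannianManifold (𝓡 c) M]

/-- A diffeomorphism whose derivative distorts norms by factors at most `C` is bi-Lipschitz for the
Riemannian distance, with constants `C⁻¹` and `C`. -/
theorem edist_bounds_of_norm_mfderiv {f : M ≃ M} (hf : ContMDiff (𝓡 c) (𝓡 c) 1 f)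
    (hf' : ContMDiff (𝓡 c) (𝓡 c) 1 f.symm) {C : ℝ} (hC : 0 < C)
    (h : ∀ (y : M) (w : TangentSpace (𝓡 c) y),
      ‖mfderiv (𝓡 c) (𝓡 c) f y w‖ ≤ C * ‖w‖ ∧ ‖w‖ ≤ C * ‖mfderiv (𝓡 c) (𝓡 c) f y w‖) (y z : M) :
    ENNReal.ofReal C⁻¹ * edist y z ≤ edist (f y) (f z) ∧
      edist (f y) (f z) ≤ ENNReal.ofReal C * edist y z := by
  refine ⟨?_, edist_map_le_of_norm_mfderiv_le hf hC (fun y w => (h y w).1) y z⟩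
  have h1 := edist_map_le_of_norm_mfderiv_le hf' hC
    (norm_mfderiv_inverse_le (hf.mdifferentiable one_ne_zero) (hf'.mdifferentiable one_ne_zero)
      (funext f.apply_symm_apply) fun y w => (h y w).2) (f y) (f z)
  rw [f.symm_apply_apply, f.symm_apply_apply] at h1
  calc ENNReal.ofReal C⁻¹ * edist y z
      ≤ ENNReal.ofReal C⁻¹ * (ENNReal.ofReal C * edist (f y) (f z)) := by gcongr
    _ = edist (f y) (f z) := by
        rw [← mul_assoc, ← ENNReal.ofReal_mul (by positivity), inv_mul_cancel₀ hC.ne',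
          ENNReal.ofReal_one, one_mul]

end Distortion

/-! ### Arcs, coverings and blending regions -/

section Blending

variable {c : ℕ} {M : Type*} [EMetricSpace M] [ChartedSpace (EuclideanSpace ℝ (Fin c)) M]
  [RiemannianBundle (fun x : M => TangentSpace (𝓡 c) x)]
  {s u : ℕ} {x : M} {e : OpenPartialHomeomorph M (SplitSpace s u)} {q R ρ : ℝ}

/-- A continuously parametrized family of diffeomorphisms, each of which is a cut-off saddle map
read in the chart, is an arc. -/
theorem isArc_of_cutoffSaddle [IsManifold (𝓡 c) ∞ M] (h : IsControlled (c := c) x e q R ρ)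
    (he : ContMDiffOn (𝓡 c) 𝓘(ℝ, SplitSpace s u) ∞ e e.source)
    (he' : ContMDiffOn 𝓘(ℝ, SplitSpace s u) (𝓡 c) ∞ e.symm e.target)
    (χ : ContDiffBump (0 : SplitSpace s u)) (hχ : χ.rOut = 2 * R) {v : SplitSpace s u} {C : ℝ}
    (hC : ∀ θ θ' : ℝ, |θ| ≤ 1 → |θ'| ≤ 1 → ∀ w,
      ‖cutoffSaddle χ v θ w - cutoffSaddle χ v θ' w‖ ≤ C * |θ - θ'|)
    {ϑ : ℝ≥0 → ℝ} (hϑ : Continuous ϑ) (hϑ1 : ∀ ε, |ϑ ε| ≤ 1) {r : ℕ∞}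
    {φ : ℝ≥0 → M ≃ₘ^r⟮𝓡 c, 𝓡 c⟯ M}
    (hφ : ∀ ε, ⇑(φ ε) = extendByChart e (cutoffSaddle χ v (ϑ ε)))
    (hinj : ∀ ε, (cutoffSaddle χ v (ϑ ε)).Injective) : IsArc r φ := by
  have hR := h.radius_pos
  have hKt : Metric.closedBall 0 (2 * R) ⊆ e.target :=
    (Metric.closedBall_subset_closedBall (by linarith)).trans h.closedBall_subset
  have hKc : IsCompact (Metric.closedBall (0 : SplitSpace s u) (2 * R)) := isCompact_closedBall _ _
  have hK : ∀ θ w, w ∉ Metric.closedBall 0 (2 * R) → cutoffSaddle χ v θ w = w := fun θ w hw =>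
    cutoffSaddle_of_notMem χ v θ (by rwa [hχ])
  constructor
  · intro ε₀
    rw [EMetric.tendstoUniformly_iff]
    intro δ hδ
    have hbound : ∀ ε y, edist (φ ε₀ y) (φ ε y) ≤ ENNReal.ofReal (4 * (C * |ϑ ε₀ - ϑ ε|)) := by
      intro ε y
      rw [hφ, hφ]
      by_cases hy : y ∈ e.symm '' Metric.closedBall 0 (2 * R)
      · obtain ⟨z, hz, rfl⟩ := hy
        have hys := e.map_target (hKt hz)
        have hmem : ∀ ε, cutoffSaddle χ v (ϑ ε) z ∈ Metric.closedBall 0 (2 * R) := fun ε =>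
          mapsTo_target_of_injective (hinj ε) Subset.rfl (hK _) hz
        have hn : ∀ ε, ‖cutoffSaddle χ v (ϑ ε) z‖ ≤ 3 * R := fun ε => by
          have : ‖cutoffSaddle χ v (ϑ ε) z‖ ≤ 2 * R := by simpa using hmem ε
          linarith
        have hr : ∀ ε, e (e.symm (cutoffSaddle χ v (ϑ ε) z)) = cutoffSaddle χ v (ϑ ε) z :=
          fun ε => e.right_inv (hKt (hmem ε))
        rw [extendByChart_of_mem hys, extendByChart_of_mem hys, e.right_inv (hKt hz)]
        refine (h.edist_le _ (e.map_target (hKt (hmem _))) _ (e.map_target (hKt (hmem _)))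
          (by rw [hr]; exact hn _) (by rw [hr]; exact hn _)).trans ?_
        rw [hr, hr]
        exact ENNReal.ofReal_le_ofReal (by linarith [hC _ _ (hϑ1 ε₀) (hϑ1 ε) z])
      · rw [extendByChart_eq_self (hK _) hy, extendByChart_eq_self (hK _) hy, edist_self]
        exact zero_le
    have hlim : Tendsto (fun ε => ENNReal.ofReal (4 * (C * |ϑ ε₀ - ϑ ε|))) (𝓝 ε₀) (𝓝 0) := by
      have : Continuous fun ε => ENNReal.ofReal (4 * (C * |ϑ ε₀ - ϑ ε|)) :=
        ENNReal.continuous_ofReal.comp (by fun_prop)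
      simpa using this.tendsto ε₀
    filter_upwards [hlim.eventually_lt_const hδ] with ε hε y
    exact (hbound ε y).trans_lt hε
  · intro ε₀ y₀ m _
    have hΨ := contMDiffAt_extendByChart he he' (g := cutoffSaddle χ v) (contDiff_cutoffSaddle χ v)
      hKc hKt hK (mapsTo_target_of_injective (hinj ε₀) hKt (hK _)) y₀
    have := continuousAt_iteratedFDeriv_of_contMDiffAt hϑ ε₀ y₀ hΨ m
    simpa only [hφ] using this

namespace IsLocalSaddle

variable {ι : Type*} {θ : ℝ} {v : ι → SplitSpace s u} {φ : ι → M ≃ M}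
  (H : IsLocalSaddle (c := c) x e q R ρ θ v φ)
include H

/-- The ball of radius `θ ^ 2 / 16` around `x` is mapped by the chart into the ball of radius
`θ ^ 2 / 4`. -/
theorem norm_lt_of_mem_eball {y : M} (hy : y ∈ Metric.eball x (ENNReal.ofReal (θ ^ 2 / 16))) :
    y ∈ e.source ∧ ‖e y‖ < θ ^ 2 / 4 := by
  have h0 := H.θ_pos
  have h1 := H.θ_lt_one
  have h2 := H.θ_le_ρ
  have hR := H.controlled.radius_pos
  rw [Metric.mem_eball, edist_comm] at hy
  obtain ⟨hys, hyn⟩ := H.controlled.near y (hy.trans_le (ENNReal.ofReal_le_ofReal (by nlinarith)))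
  refine ⟨hys, ?_⟩
  have h3 := H.controlled.le_edist y hys x H.mem_source (by linarith)
    (by rw [H.map_base, norm_zero]; linarith)
  rw [H.map_base, sub_zero, edist_comm] at h3
  have h4 : ENNReal.ofReal ‖e y‖ < ENNReal.ofReal (θ ^ 2 / 4) := by
    refine h3.trans_lt ?_
    calc 4 * edist x y < 4 * ENNReal.ofReal (θ ^ 2 / 16) :=
          ENNReal.mul_lt_mul_right (by simp) (by simp) hy
      _ = ENNReal.ofReal (θ ^ 2 / 4) := by
          rw [show (4 : ℝ≥0∞) = ENNReal.ofReal 4 by simp, ← ENNReal.ofReal_mul (by norm_num)]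
          congr 1
          ring
  exact (ENNReal.ofReal_lt_ofReal_iff (by positivity)).1 h4

theorem edist_lt_of_norm_lt {y : M} (hy : y ∈ e.source) (hyn : ‖e y‖ ≤ R) {a : ℝ}
    (ha : 4 * ‖e y‖ < a) : edist x y < ENNReal.ofReal a := by
  have hR := H.controlled.radius_pos
  refine (H.controlled.edist_le x H.mem_source y hy (by rw [H.map_base, norm_zero]; linarith)
    (by linarith)).trans_lt ?_
  rw [H.map_base, zero_sub, norm_neg]
  exact (ENNReal.ofReal_lt_ofReal_iff (by linarith [norm_nonneg (e y)])).2 ha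

theorem closure_eball_subset {y : M}
    (hy : y ∈ closure (Metric.eball x (ENNReal.ofReal (θ ^ 2 / 16)))) :
    y ∈ e.source ∧ ‖e y‖ ≤ θ ^ 2 / 4 := by
  have h0 := H.θ_pos
  have h1 := H.θ_lt_one
  have h2 := H.θ_le_radius
  refine closure_subset_of_norm_le (H.closedBall_subset (by nlinarith)) (fun z hz => ?_) hy
  have := H.norm_lt_of_mem_eball hz
  exact ⟨this.1, this.2.le⟩

/-- A net of the ball of radius `2` yields a net of the ball of radius `θ ^ 2 / 2` by translation
vectors. -/
theorem exists_translation (hnet : ∀ w, ‖w‖ ≤ 2 → ∃ i, ‖w - v i‖ < 1 / 32) {w : SplitSpace s u}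
    (hw : ‖w‖ ≤ θ ^ 2 / 2) : ∃ i, ‖w - (θ ^ 2 / 4) • v i‖ < θ ^ 2 / 128 := by
  have h0 := H.θ_pos
  have hpos : 0 < θ ^ 2 / 4 := by positivity
  obtain ⟨i, hi⟩ := hnet ((θ ^ 2 / 4)⁻¹ • w) (by
    rw [norm_smul, Real.norm_of_nonneg (by positivity), inv_mul_le_iff₀ hpos]
    linarith)
  refine ⟨i, ?_⟩
  have : w - (θ ^ 2 / 4) • v i = (θ ^ 2 / 4) • ((θ ^ 2 / 4)⁻¹ • w - v i) := by
    rw [smul_sub, smul_smul, mul_inv_cancel₀ hpos.ne', one_smul]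
  rw [this, norm_smul, Real.norm_of_nonneg hpos.le]
  calc θ ^ 2 / 4 * ‖(θ ^ 2 / 4)⁻¹ • w - v i‖ < θ ^ 2 / 4 * (1 / 32) := by gcongr
    _ = θ ^ 2 / 128 := by ring

/-- The net provides a translation part that brings `e y` to distance `θ ^ 2 / 128` from the origin.
The inverse of the linear saddle at most doubles norms, and the ball of radius `θ ^ 2 / 64` of the
chart lies in the ball of radius `θ ^ 2 / 16` around `x`. -/
theorem cs_cover (hθ : θ ≤ 1 / 2) (hnet : ∀ w, ‖w‖ ≤ 2 → ∃ i, ‖w - v i‖ < 1 / 32) :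
    closure (Metric.eball x (ENNReal.ofReal (θ ^ 2 / 16)))
      ⊆ ⋃ i, φ i '' Metric.eball x (ENNReal.ofReal (θ ^ 2 / 16)) := by
  intro y hy
  have h0 := H.θ_pos
  have h1 := H.θ_le_radius
  obtain ⟨hys, hyn⟩ := H.closure_eball_subset hy
  obtain ⟨i, hi⟩ := H.exists_translation hnet (w := e y) (by nlinarith)
  set w := e y - (θ ^ 2 / 4) • v i
  -- `z` is the preimage of `e y` under the affine saddle map
  let z : SplitSpace s u := ((1 - θ)⁻¹ • w.1, (1 + θ)⁻¹ • w.2)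
  have hAz : affineSaddle θ 0 z = w := by
    refine Prod.ext ?_ ?_
    · rw [affineSaddle_zero_fst, smul_smul, mul_inv_cancel₀ (by linarith), one_smul]
    · rw [affineSaddle_zero_snd, smul_smul, mul_inv_cancel₀ (by linarith), one_smul]
  have hzn : ‖z‖ ≤ 2 * ‖w‖ := by
    refine max_le ?_ ?_
    · rw [norm_smul, Real.norm_of_nonneg (inv_nonneg.2 (by linarith))]
      gcongr
      · rw [inv_le_comm₀ (by linarith) (by norm_num)]; linarith
      · exact norm_fst_le _
    · rw [norm_smul, Real.norm_of_nonneg (inv_nonneg.2 (by linarith))]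
      gcongr
      · rw [inv_le_comm₀ (by linarith) (by norm_num)]; linarith
      · exact norm_snd_le _
  have hz2 : ‖z‖ < θ ^ 2 / 64 := by linarith
  have hzR : ‖z‖ ≤ R := by nlinarith
  have hzt : z ∈ e.target := H.closedBall_subset le_rfl (by simpa using hzR)
  have hzs := e.map_target hzt
  have hez := e.right_inv hzt
  have hezR : ‖e (e.symm z)‖ ≤ R := by rwa [hez]
  refine mem_iUnion.2 ⟨i, e.symm z, ?_, ?_⟩
  · rw [Metric.mem_eball, edist_comm]
    exact H.edist_lt_of_norm_lt hzs hezR (by rw [hez]; linarith)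
  · rw [← e.left_inv (H.map_mem i _ hzs hezR), H.map_eq i _ hzs hezR, hez, affineSaddle_eq, hAz,
      sub_add_cancel, e.left_inv hys]

/-- The linear saddle at most doubles norms, and the net provides a translation part that brings the
image of `e y` to distance `θ ^ 2 / 128` from the origin. -/
theorem cu_cover (hnet : ∀ w, ‖w‖ ≤ 2 → ∃ i, ‖w - v i‖ < 1 / 32) :
    closure (Metric.eball x (ENNReal.ofReal (θ ^ 2 / 16)))
      ⊆ ⋃ i, (φ i).symm '' Metric.eball x (ENNReal.ofReal (θ ^ 2 / 16)) := by
  intro y hy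
  have h0 := H.θ_pos
  have h1 := H.θ_le_radius
  have h2 := H.θ_lt_one
  obtain ⟨hys, hyn⟩ := H.closure_eball_subset hy
  have hyR : ‖e y‖ ≤ R := by nlinarith
  have hA : ‖affineSaddle θ 0 (e y)‖ ≤ θ ^ 2 / 2 := by
    have h3 : ‖affineSaddle θ 0 (e y)‖ ≤ 2 * ‖e y‖ := by
      refine max_le ?_ ?_
      · rw [affineSaddle_zero_fst, norm_smul, Real.norm_of_nonneg (by linarith)]
        gcongr
        · linarith
        · exact norm_fst_le _
      · rw [affineSaddle_zero_snd, norm_smul, Real.norm_of_nonneg (by linarith)]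
        gcongr
        · linarith
        · exact norm_snd_le _
    linarith
  obtain ⟨i, hi⟩ := H.exists_translation hnet (w := -affineSaddle θ 0 (e y)) (by rwa [norm_neg])
  refine mem_iUnion.2 ⟨i, φ i y, ?_, (φ i).symm_apply_apply y⟩
  rw [← norm_neg, neg_sub, sub_neg_eq_add, add_comm, ← affineSaddle_eq, ← H.map_eq i y hys hyR] at hi
  rw [Metric.mem_eball, edist_comm]
  exact H.edist_lt_of_norm_lt (H.map_mem i y hys hyR) (by nlinarith) (by nlinarith)

theorem chartBall_subset_eball {ε : ℝ≥0} (hε : 4 * θ ≤ ε) :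
    chartBall e θ ⊆ Metric.eball x (2 * (ε : ℝ≥0∞)) := by
  rintro y ⟨hys, hyn⟩
  have h0 := H.θ_pos
  have h1 := H.θ_le_radius
  have hyn' : ‖e y‖ < θ := by simpa using hyn
  have h2 := H.edist_lt_of_norm_lt hys (by linarith) (a := ε) (by linarith)
  rw [Metric.mem_eball, edist_comm]
  rw [ENNReal.ofReal_coe_nnreal] at h2
  exact h2.trans_le (le_mul_of_one_le_left' (by norm_num))

theorem closure_eball_subset_chartBall :
    closure (Metric.eball x (ENNReal.ofReal (θ ^ 2 / 16))) ⊆ chartBall e θ := by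
  intro y hy
  have h0 := H.θ_pos
  have h1 := H.θ_lt_one
  obtain ⟨hys, hyn⟩ := H.closure_eball_subset hy
  refine ⟨hys, ?_⟩
  rw [mem_preimage, mem_ball_zero_iff]
  nlinarith

end IsLocalSaddle

/-- Diffeomorphisms that are affine saddle maps near `x` satisfy all requirements on blending
regions except for the covering properties. -/
theorem IsLocalSaddle.isBlendingData {ι : Type*} [TopologicalSpace ι] [DiscreteTopology ι]
    [Finite ι] [Nonempty ι] {θ : ℝ} {v : ι → SplitSpace s u} {r : ℕ∞}
    {φ : ι → M ≃ₘ^r⟮𝓡 c, 𝓡 c⟯ M}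
    (H : IsLocalSaddle (c := c) x e q R ρ θ v fun i => (φ i).toEquiv) (hq : 0 < q)
    (he : ContMDiffOn (𝓡 c) 𝓘(ℝ, SplitSpace s u) ∞ e e.source) (hsu : s + u = c) {ν α : ℝ}
    (hph : IsPartiallyHyperbolic ν α fun i => (φ i).toEquiv) {ε : ℝ≥0} (hε : 4 * θ ≤ ε) :
    IsBlendingData ν α r φ (Metric.eball x (ENNReal.ofReal (θ ^ 2 / 16))) (chartBall e θ) s u where
  partiallyHyperbolic := hph
  isOpen_B := Metric.isOpen_eball
  isOpen_D := e.isOpen_inter_preimage Metric.isOpen_ball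
  bounded_B := (Metric.ediam_eball_le.trans_lt
    (ENNReal.mul_lt_top (by simp) ENNReal.ofReal_lt_top)).ne
  bounded_D := ((Metric.ediam_mono (H.chartBall_subset_eball hε)).trans_lt
    (Metric.ediam_eball_le.trans_lt
      (ENNReal.mul_lt_top (by simp) (ENNReal.mul_lt_top (by simp) ENNReal.coe_lt_top)))).ne
  closure_subset := H.closure_eball_subset_chartBall
  hyperbolic :=
    { isCompact := H.isCompact_maximalInvariantSet
      image_eq := image_maximalInvariantSet _
      topological := H.isTopologicallyHyperbolic
      differentiable := fun hr => by
        have hr' : (r : ℕ∞ω) ≠ 0 := by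
          have : r ≠ 0 := (zero_lt_one.trans_le hr).ne'
          exact_mod_cast this
        exact H.isDifferentiablyHyperbolic hsu he hq (fun i => (φ i).mdifferentiable hr')
          fun i => (φ i).symm.mdifferentiable hr' }
  transitive := H.isTransitiveSet

end Blending

/-! ### Choice of the constants -/

section Constants

/-- The number of translation vectors can be chosen to depend on the dimension only. -/
theorem exists_uniform_net (c : ℕ) : ∃ k : ℕ, 2 ≤ k ∧ ∀ s u : ℕ, s + u = c →
    ∃ v : Fin k → SplitSpace s u, (∀ i, ‖v i‖ ≤ 2) ∧
      ∀ w, ‖w‖ ≤ 2 → ∃ i, ‖w - v i‖ < 1 / 32 := by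
  choose K hK using exists_net
  refine ⟨2 + ∑ p ∈ Finset.range (c + 1) ×ˢ Finset.range (c + 1), K p.1 p.2, by omega,
    fun s u hsu => hK s u _ ?_⟩
  have := Finset.single_le_sum (f := fun p : ℕ × ℕ => K p.1 p.2) (fun _ _ => Nat.zero_le _)
    (s := Finset.range (c + 1) ×ˢ Finset.range (c + 1)) (a := (s, u)) (by simp; omega)
  dsimp only at this
  omega

theorem exists_distortion_lt {a : ℝ} (ha : 1 < a) : ∃ q : ℝ, 1 < q ∧ q ^ 3 < a := by
  have h : ∀ᶠ q : ℝ in 𝓝[>] 1, q ^ 3 < a := by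
    refine nhdsWithin_le_nhds ((continuous_pow 3).continuousAt.eventually_lt_const ?_)
    simpa using ha
  obtain ⟨q, hq, hq1⟩ := (h.and self_mem_nhdsWithin).exists
  exact ⟨q, hq1, hq⟩

/-- Blending regions homotopic to the identity, of any `cs`-index. -/
theorem mainTheorem7 (c : ℕ) (hc : 1 ≤ c) :
    ∃ k : ℕ, 2 ≤ k ∧
      ∀ (M : Type*) [EMetricSpace M] [ChartedSpace (EuclideanSpace ℝ (Fin c)) M]
        [IsManifold (𝓡 c) ∞ M] [RiemannianBundle (fun x : M => TangentSpace (𝓡 c) x)]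
        [IsContinuousRiemannianBundle (EuclideanSpace ℝ (Fin c))
          (fun x : M => TangentSpace (𝓡 c) x)]
        [IsRiemannianManifold (𝓡 c) M]
        (r : ℕ∞) (ν α : ℝ), 0 < ν → ν < 1 → 0 < α →
        ∀ (x : M) (s u : ℕ), s + u = c →
          ∃ (φ : Fin k → ℝ≥0 → M ≃ₘ^r⟮𝓡 c, 𝓡 c⟯ M) (D : ℝ≥0 → Set M) (δ : ℝ≥0 → ℝ),
            (∀ i, IsArc r (φ i)) ∧
            (∀ i, φ i 0 = Diffeomorph.refl (𝓡 c) M r) ∧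
            ∀ ε : ℝ≥0, 0 < ε →
              D ε ⊆ Metric.eball x (2 * (ε : ℝ≥0∞)) ∧
              0 < δ ε ∧
              Metric.eball x (ENNReal.ofReal (δ ε)) ⊆ D ε ∧
              (0 < s → IsCsBlendingRegion ν α r (fun i => φ i ε)
                (Metric.eball x (ENNReal.ofReal (δ ε))) (D ε) s u) ∧
              (0 < u → IsCuBlendingRegion ν α r (fun i => φ i ε)
                (Metric.eball x (ENNReal.ofReal (δ ε))) (D ε) s u) := by
  obtain ⟨k, hk, hnets⟩ := exists_uniform_net c
  refine ⟨k, hk, ?_⟩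
  intro M _ _ _ _ _ _ r ν α hν hν1 hα x s u hsu
  obtain ⟨v, hv, hnet⟩ := hnets s u hsu
  have : Nonempty (Fin k) := ⟨⟨0, by omega⟩⟩
  -- the constants of partial hyperbolicity are `q ^ 3` and its inverse
  obtain ⟨q, hq, hqν⟩ := exists_distortion_lt (Real.one_lt_rpow_of_pos_of_lt_one_of_neg hν hν1
    (neg_lt_zero.2 hα))
  obtain ⟨e, he⟩ := exists_isNormalizedChart (c := c) hsu x
  obtain ⟨R, ρ, hctrl⟩ := he.exists_isControlled hq
  have hR := hctrl.radius_pos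
  have hρ := hctrl.ρ_pos
  let χ : ContDiffBump (0 : SplitSpace s u) := ⟨R, 2 * R, hR, by linarith⟩
  obtain ⟨C, hC, hCχ⟩ := exists_bound_cutoffSaddle χ
  -- the admissible `C^1`-distance to the identity
  let τ : ℝ := (1 - q⁻¹) / 2
  have hq0 : 0 < q⁻¹ := inv_pos.2 (by linarith)
  have hτ : 0 < τ := half_pos (sub_pos.2 (inv_lt_one_of_one_lt₀ hq))
  have hτ2 : τ ≤ 1 / 2 := by simp only [τ]; linarith
  obtain ⟨θ₀, hθ₀, hθ1, hθR, hθρ, hθτ⟩ : ∃ θ₀ : ℝ, 0 < θ₀ ∧ θ₀ ≤ 1 / 2 ∧ 2 * θ₀ ≤ R ∧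
      8 * θ₀ ≤ ρ ∧ C * θ₀ ≤ τ := by
    refine ⟨min (min (1 / 2) (R / 2)) (min (ρ / 8) (τ / C)), by positivity, ?_, ?_, ?_, ?_⟩
    · exact (min_le_left _ _).trans (min_le_left _ _)
    · have := (min_le_left (min (1 / 2) (R / 2)) (min (ρ / 8) (τ / C))).trans (min_le_right _ _)
      linarith
    · have := (min_le_right (min (1 / 2) (R / 2)) (min (ρ / 8) (τ / C))).trans (min_le_left _ _)
      linarith
    · have := (min_le_right (min (1 / 2) (R / 2)) (min (ρ / 8) (τ / C))).trans (min_le_right _ _)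
      rwa [le_div_iff₀' hC] at this
  -- `ε / 4` makes `D ε` small and `θ₀` keeps the maps `C^1`-close to the identity for large `ε`
  let ϑ : ℝ≥0 → ℝ := fun ε => min ((ε : ℝ) / 4) θ₀
  have hϑc : Continuous ϑ := by fun_prop
  have hϑ0 : ∀ ε, 0 ≤ ϑ ε := fun ε => le_min (by positivity) hθ₀.le
  have hϑle : ∀ ε, ϑ ε ≤ θ₀ := fun ε => min_le_right _ _
  have hϑ1 : ∀ ε, |ϑ ε| ≤ 1 := fun ε => by
    rw [abs_of_nonneg (hϑ0 ε)]; linarith [hϑle ε]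
  have hfd : ∀ i ε w, ‖fderiv ℝ (cutoffSaddle χ (v i) (ϑ ε)) w - ContinuousLinearMap.id ℝ _‖
      ≤ τ := fun i ε w => by
    refine ((hCχ (v i) (hv i)).1 _ (hϑ1 ε) w).trans (le_trans ?_ hθτ)
    rw [abs_of_nonneg (hϑ0 ε)]
    exact mul_le_mul_of_nonneg_left (hϑle ε) hC.le
  have hsm : ∀ i ε, ContDiff ℝ ∞ (cutoffSaddle χ (v i) (ϑ ε)) := fun i ε =>
    (contDiff_cutoffSaddle χ (v i)).comp (contDiff_const.prodMk contDiff_id)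
  have hequiv : ∀ i ε, ∃ g : SplitSpace s u ≃ SplitSpace s u,
      ⇑g = cutoffSaddle χ (v i) (ϑ ε) ∧ ContDiff ℝ ∞ g.symm := fun i ε =>
    exists_equiv_of_norm_fderiv_sub_id_le (hsm i ε) fun w => (hfd i ε w).trans hτ2
  choose g hg hgsymm using hequiv
  have hKt : Metric.closedBall 0 (2 * R) ⊆ e.target :=
    (Metric.closedBall_subset_closedBall (by linarith)).trans hctrl.closedBall_subset
  have hKc : IsCompact (Metric.closedBall (0 : SplitSpace s u) (2 * R)) := isCompact_closedBall _ _
  have hgK : ∀ i ε w, w ∉ Metric.closedBall 0 (2 * R) → g i ε w = w := fun i ε w hw => by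
    rw [hg]; exact cutoffSaddle_of_notMem χ (v i) _ hw
  have hgsm : ∀ i ε, ContDiff ℝ ∞ (g i ε) := fun i ε => by rw [hg]; exact hsm i ε
  let φ : Fin k → ℝ≥0 → M ≃ₘ^r⟮𝓡 c, 𝓡 c⟯ M := fun i ε =>
    chartDiffeomorph he.contMDiffOn he.contMDiffOn_symm hKc hKt (g i ε) (hgsm i ε) (hgsymm i ε)
      (hgK i ε) r
  have hφ : ∀ i ε, ⇑(φ i ε) = extendByChart e (g i ε) := fun i ε => rfl
  have hφsymm : ∀ i ε, ⇑(φ i ε).toEquiv.symm = extendByChart e (g i ε).symm := fun i ε => rfl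
  have hph : ∀ ε, IsPartiallyHyperbolic ν α fun i => (φ i ε).toEquiv := by
    intro ε
    refine ⟨(q ^ 3)⁻¹, q ^ 3, ?_, hqν, fun i y z => ?_⟩
    · rw [Real.rpow_neg hν.le] at hqν
      exact (lt_inv_comm₀ (by positivity) (by positivity)).1 hqν
    · refine edist_bounds_of_norm_mfderiv (c := c) (f := (φ i ε).toEquiv) ?_ ?_ (by positivity)
        (fun y w => ?_) y z
      · exact (contMDiff_extendByChart he.contMDiffOn he.contMDiffOn_symm (hgsm i ε)
          (g i ε).injective hKc hKt (hgK i ε)).of_le (by norm_num)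
      · exact (contMDiff_extendByChart he.contMDiffOn he.contMDiffOn_symm (hgsymm i ε)
          (g i ε).symm.injective hKc hKt
          fun w hw => by rw [Equiv.symm_apply_eq, hgK i ε w hw]).of_le (by norm_num)
      · exact hctrl.norm_mfderiv_extendByChart hq he.contMDiffOn he.contMDiffOn_symm (hgsm i ε)
          (g i ε).injective (hgK i ε) (τ := τ) (by simp only [τ]; linarith)
          (by rw [hg]; exact hfd i ε) y w
  have hloc : ∀ ε, 0 < ε →
      IsLocalSaddle (c := c) x e q R ρ (ϑ ε) v fun i => (φ i ε).toEquiv := by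
    intro ε hε
    refine ⟨hctrl, he.mem_source, he.map_base, lt_min (by positivity) hθ₀, ?_, ?_, ?_, hv, ?_, ?_⟩
    · linarith [hϑle ε]
    · linarith [hϑle ε]
    · linarith [hϑle ε]
    · intro i y hy _
      change extendByChart e (g i ε) y ∈ e.source
      rw [extendByChart_of_mem hy]
      exact e.map_target (mapsTo_target_of_injective (g i ε).injective hKt (hgK i ε)
        (e.map_source hy))
    · intro i y hy hyn
      change e (extendByChart e (g i ε) y) = _
      rw [extendByChart_of_mem hy, e.right_inv (mapsTo_target_of_injective (g i ε).injective hKt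
        (hgK i ε) (e.map_source hy)), hg]
      exact cutoffSaddle_of_mem χ (v i) _ hyn
  refine ⟨φ, fun ε => chartBall e (ϑ ε), fun ε => ϑ ε ^ 2 / 16, fun i => ?_, fun i => ?_,
    fun ε hε => ?_⟩
  · exact isArc_of_cutoffSaddle hctrl he.contMDiffOn he.contMDiffOn_symm χ rfl
      (hCχ (v i) (hv i)).2 hϑc hϑ1 (fun ε => by rw [hφ, hg])
      (fun ε => by rw [← hg]; exact (g i ε).injective)
  · ext y
    have hϑz : ϑ 0 = 0 := by simp [ϑ, hθ₀.le]
    rw [hφ, extendByChart_eq_self (K := ∅) (fun w _ => ?_) (by simp)]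
    · rfl
    · rw [hg, hϑz, cutoffSaddle_zero]
  · have H := hloc ε hε
    have h4 : 4 * ϑ ε ≤ ε := by
      have : ϑ ε ≤ (ε : ℝ) / 4 := min_le_left _ _
      linarith
    have hq00 : 0 < q := by linarith
    have hθpos := H.θ_pos
    exact ⟨H.chartBall_subset_eball h4, by positivity,
      subset_closure.trans H.closure_eball_subset_chartBall,
      fun hs => ⟨H.isBlendingData hq00 he.contMDiffOn hsu (hph ε) h4,
        H.cs_cover ((hϑle ε).trans hθ1) hnet, hs⟩,
      fun hu => ⟨H.isBlendingData hq00 he.contMDiffOn hsu (hph ε) h4, H.cu_cover hnet, hu⟩⟩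

end Constants
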